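/- Let \(n\ge 0\) and let \((N,g)\) be a closed (compact, without boundary) smooth Riemannian manifold of dimension \(n+1\). Let \(W:\mathbb R\to[0,\infty)\) be a smooth symmetric double well potential: \(W(-t)=W(t)\) for all \(t\), the critical points of \(W\) are exactly \(0\) and \(\pm1\), \(W(\pm1)=0\), \(W''(\pm1)>0\), and \(0\) is a local maximum of \(W\). Let \(\varepsilon>0\). Let \(H^1(N)\) be the space of all \(u\in L^2(N)\) whose distributional gradient \(\nabla u\) is in \(L^2(N,TN)\), with norm \(\|u\|=\left(\int_N |u|^2+|\nabla u|^2\right)^{1/2}\), and for \(u\in H^1(N)\) put \[E_\varepsilon(u)=\int_N \varepsilon\frac{|\nabla u|^2}{2}+\frac{W(u)}{\varepsilon}.\] Inequalities between functions are understood almost everywhere. A continuous map \(\psi:[0,1]\to H^1(N)\) is called nested if \(\psi(t)\ge\psi(s)\) whenever \(t\le s\). Let \(\varphi:[0,1]\to H^1(N)\) be a continuous map such that \(|\varphi(t)|\le 1\) for all \(t\in[0,1]\), and let \(\kappa>0\). Then there exists a nested map \(\psi:[0,1]\to H^1(N)\) such that \(\psi(0)\ge\varphi(0)\), \(\psi(1)\le\varphi(1)\),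 \(|\psi(t)|\le1\) for all \(t\in[0,1]\), and \[\sup_{t\in[0,1]}E_\varepsilon(\psi(t))\le\sup_{t\in[0,1]}E_\varepsilon(\varphi(t))+\kappa.\] -/

import Mathlib

open scoped Manifold ContDiff Topology ENNReal
open MeasureTheory Set Filter

noncomputable section

namespace AllenCahn

/-- The model space `ℝ^(n+1)` of an `(n+1)`-dimensional manifold, with its Euclidean norm. -/
abbrev Model (n : ℕ) : Type := EuclideanSpace ℝ (Fin (n + 1))

/-- A smooth Riemannian metric on an `(n+1)`-dimensional smooth manifold `N` (without boundary);
`g.inner x v w` is the inner product of two tangent vectors `v`, `w` at `x`. -/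
abbrev SmoothMetric (n : ℕ) (N : Type*) [TopologicalSpace N] [ChartedSpace (Model n) N]
    [IsManifold (𝓡 (n + 1)) ∞ N] : Type _ :=
  Bundle.ContMDiffRiemannianMetric (𝓡 (n + 1)) ∞ (Model n)
    (fun x : N => TangentSpace (𝓡 (n + 1)) x)

/-- The smooth charts of `N`: all charts of the maximal smooth atlas. -/
abbrev charts (n : ℕ) (N : Type*) [TopologicalSpace N] [ChartedSpace (Model n) N] :
    Set (OpenPartialHomeomorph N (Model n)) :=
  IsManifold.maximalAtlas (𝓡 (n + 1)) ∞ N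

section Riemannian

variable {n : ℕ} {N : Type*} [TopologicalSpace N] [ChartedSpace (Model n) N]

/-- The coordinate vector field `∂ᵢ` of the chart `e`, at the point with coordinates `y`. -/
def coordVec (e : OpenPartialHomeomorph N (Model n)) (y : Model n) (i : Fin (n + 1)) :
    TangentSpace (𝓡 (n + 1)) (e.symm y) :=
  mfderiv (𝓡 (n + 1)) (𝓡 (n + 1)) e.symm y (EuclideanSpace.single i (1 : ℝ) : Model n)

/-- The vector in `ℝ^(n+1)` of the components of the vector field `X` in the chart `e`, as a
function of the coordinates `y`. -/
def coords (e : OpenPartialHomeomorph N (Model n))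
    (X : (x : N) → TangentSpace (𝓡 (n + 1)) x) (y : Model n) : Model n :=
  mfderiv (𝓡 (n + 1)) (𝓡 (n + 1)) e (e.symm y) (X (e.symm y))

variable [IsManifold (𝓡 (n + 1)) ∞ N]

/-- The matrix `g_ij = g(∂ᵢ, ∂ⱼ)` of the metric in the chart `e`. -/
def gram (g : SmoothMetric n N) (e : OpenPartialHomeomorph N (Model n)) (y : Model n) :
    Matrix (Fin (n + 1)) (Fin (n + 1)) ℝ :=
  Matrix.of fun i j => g.inner (e.symm y) (coordVec e y i) (coordVec e y j)

variable [MeasurableSpace N]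

/-- The Riemannian volume of the domain of the chart `e`, as a measure on `N` carried by that
domain: the image under `e⁻¹` of the measure `√(det g_ij) dy` on the range of `e`. -/
def chartVolume (g : SmoothMetric n N) (e : OpenPartialHomeomorph N (Model n)) : Measure N :=
  ((volume.restrict e.target).withDensity
    fun y => ENNReal.ofReal (Real.sqrt (gram g e y).det)).map e.symm

/-- The Riemannian volume measure of `(N, g)`: the least measure on `N` that dominates the chart
volume of every smooth chart. By the change of variables formula, the chart volumes of two charts
agree on the intersection of their domains, so that (on a manifold with a countable atlas) this
least measure is the one that restricts to `√(det g_ij) dy` on every chart domain. -/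
def vol (g : SmoothMetric n N) : Measure N :=
  ⨆ e ∈ charts n N, chartVolume g e

/-- `X` is the distributional gradient of the function `u`: `X` is a measurable vector field (its
components in every chart are measurable) and, in every chart, the `i`-th distributional
derivative of `u` is `g(X, ∂ᵢ)`. -/
structure IsWeakGradient (g : SmoothMetric n N) (u : N → ℝ)
    (X : (x : N) → TangentSpace (𝓡 (n + 1)) x) : Prop where
  measurable_coords : ∀ e ∈ charts n N,
    AEStronglyMeasurable (coords e X) (volume.restrict e.target)
  integral_eq : ∀ e ∈ charts n N, ∀ η : Model n → ℝ,
    ContDiff ℝ ∞ η → HasCompactSupport η → tsupport η ⊆ e.target → ∀ i : Fin (n + 1),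
      ∫ y, u (e.symm y) * fderiv ℝ η y (EuclideanSpace.single i 1) =
        - ∫ y, g.inner (e.symm y) (X (e.symm y)) (coordVec e y i) * η y

/-- The Sobolev space `H¹(N)`: the (classes of) functions in `L²(N)` whose distributional gradient
belongs to `L²(N, TN)`. -/
def H1 (g : SmoothMetric n N) : Type _ :=
  {u : Lp ℝ 2 (vol g) // ∃ X : (x : N) → TangentSpace (𝓡 (n + 1)) x,
    IsWeakGradient g u X ∧ ∫⁻ x, ENNReal.ofReal (g.inner x (X x) (X x)) ∂(vol g) < ⊤}

/-- An element of `H¹(N)` as a function, defined up to equality almost everywhere. -/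
instance (g : SmoothMetric n N) : CoeFun (H1 g) (fun _ => N → ℝ) := ⟨fun u => (u.1 : N → ℝ)⟩

/-- The gradient `∇u` of `u ∈ H¹(N)` (unique up to equality almost everywhere). -/
def H1.grad {g : SmoothMetric n N} (u : H1 g) : (x : N) → TangentSpace (𝓡 (n + 1)) x :=
  u.2.choose

/-- The distance `‖u - v‖ = (∫ |u - v|² + |∇u - ∇v|²)^(1/2)` given by the norm of `H¹(N)`. -/
def H1.normDist {g : SmoothMetric n N} (u v : H1 g) : ℝ≥0∞ :=
  (∫⁻ x, ENNReal.ofReal ((u x - v x) ^ 2 +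
    g.inner x (u.grad x - v.grad x) (u.grad x - v.grad x)) ∂(vol g)) ^ (1 / 2 : ℝ)

/-- Continuity of a path `φ : [0,1] → H¹(N)` with respect to the norm of `H¹(N)`. -/
def ContinuousPath {g : SmoothMetric n N} (φ : unitInterval → H1 g) : Prop :=
  ∀ t, Tendsto (fun s => (φ s).normDist (φ t)) (𝓝 t) (𝓝 0)

/-- A nested path `[0,1] → H¹(N)`: continuous, and `ψ(t) ≥ ψ(s)` a.e. whenever `t ≤ s`. -/
structure IsNested {g : SmoothMetric n N} (ψ : unitInterval → H1 g) : Prop where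
  continuousPath : ContinuousPath ψ
  antitone : ∀ t s : unitInterval, t ≤ s → ∀ᵐ x ∂(vol g), ψ s x ≤ ψ t x

/-- The Allen–Cahn energy `E_ε(u) = ∫ ε |∇u|² / 2 + W(u) / ε`, the integral of a nonnegative
function. -/
def energy {g : SmoothMetric n N} (W : ℝ → ℝ) (ε : ℝ) (u : H1 g) : ℝ≥0∞ :=
  ∫⁻ x, ENNReal.ofReal (ε * g.inner x (u.grad x) (u.grad x) / 2 + W (u x) / ε) ∂(vol g)

end Riemannian

/-- A smooth symmetric double well potential `W : ℝ → [0,∞)`: its critical points are exactly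
`0, 1, -1`; `±1` are nondegenerate minima with value `0`, and `0` is a local maximum. -/
structure IsDoubleWell (W : ℝ → ℝ) : Prop where
  contDiff : ContDiff ℝ ∞ W
  nonneg : ∀ t, 0 ≤ W t
  even : ∀ t, W (-t) = W t
  deriv_eq_zero_iff : ∀ t, deriv W t = 0 ↔ t = 0 ∨ t = 1 ∨ t = -1
  apply_one : W 1 = 0
  apply_neg_one : W (-1) = 0
  deriv2_one : 0 < deriv (deriv W) 1
  deriv2_neg_one : 0 < deriv (deriv W) (-1)
  isLocalMax : IsLocalMax W 0

end AllenCahn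

end

/-!
Decreasing paths of energy at most `L` can be concatenated: if one ends below the starting point of
the next, let `z` almost minimize the energy between these two functions, follow `α_t ⊔ z` along the
first path `α` and then `β_t ⊓ z` along the second path `β`. Since
`E(u ⊔ v) + E(u ⊓ v) = E(u) + E(v)` and `α_t ⊓ z`, `β_t ⊔ z` are competitors in the choice of `z`,
this increases the energy by an arbitrarily small amount only. On the other hand, if `v` is close to
`u`, the segments from `u` and from `v` to `u ⊓ v` have almost the energy of `u`; here the energy is
upper semicontinuous because Glaeser's inequality `W'² ≤ 4 K W` bounds `W(b)` by
`(1 + δ) W(a) + C (b - a)²`. As `[0,1]` is connected, the local steps along `φ` link `φ(0)` to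
`φ(1)`. The lattice operations on `H¹(N)` and their continuity follow from the chain rule
`∇|u| = sign(u) ∇u`.
-/

noncomputable section

namespace AllenCahn

section LocallyIntegrable

variable {X : Type*} [TopologicalSpace X] [T2Space X] [MeasurableSpace X] [BorelSpace X]
  {μ : Measure X}

theorem integrable_mul_of_tsupport_subset {Ω : Set X} {u χ : X → ℝ}
    (hu : LocallyIntegrableOn u Ω μ) (hχ : Continuous χ) (hχc : HasCompactSupport χ)
    (hχΩ : tsupport χ ⊆ Ω) : Integrable (fun y => u y * χ y) μ := by
  have hint : IntegrableOn (fun y => u y * χ y) (tsupport χ) μ :=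
    (hu.integrableOn_compact_subset hχΩ hχc).mul_continuousOn hχ.continuousOn hχc
  rwa [integrableOn_iff_integrable_of_support_subset] at hint
  exact fun y hy => subset_tsupport χ (right_ne_zero_of_mul hy)

theorem tendsto_integral_mul_of_tendsto_lintegral {ι : Type*} {l : Filter ι} {U : ι → X → ℝ}
    {u χ : X → ℝ} (hχ : Continuous χ) (hχc : HasCompactSupport χ)
    (hU : ∀ i, AEStronglyMeasurable (U i) (μ.restrict (tsupport χ)))
    (hu : IntegrableOn u (tsupport χ) μ)
    (hUu : Tendsto (fun i => ∫⁻ x in tsupport χ, ‖U i x - u x‖ₑ ∂μ) l (𝓝 0)) :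
    Tendsto (fun i => ∫ x, U i x * χ x ∂μ) l (𝓝 (∫ x, u x * χ x ∂μ)) := by
  have hset (w : X → ℝ) : ∫ x, w x * χ x ∂μ = ∫ x in tsupport χ, w x * χ x ∂μ :=
    (setIntegral_eq_integral_of_forall_compl_eq_zero fun x hx => by
      rw [image_eq_zero_of_notMem_tsupport hx, mul_zero]).symm
  obtain ⟨C, hC⟩ := hχ.bounded_above_of_compact_support hχc
  simp only [hset]
  refine tendsto_integral_of_L1 _ (hu.1.mul hχ.aestronglyMeasurable) ?_ ?_
  · filter_upwards [hUu.eventually (gt_mem_nhds zero_lt_one)] with i hi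
    have hsub : IntegrableOn (U i - u) (tsupport χ) μ :=
      ⟨(hU i).sub hu.1, hi.trans ENNReal.one_lt_top⟩
    have hUi : IntegrableOn (U i) (tsupport χ) μ := by simpa using hsub.add hu
    exact hUi.mul_continuousOn hχ.continuousOn hχc
  · refine tendsto_of_tendsto_of_tendsto_of_le_of_le tendsto_const_nhds
      (by simpa using ENNReal.Tendsto.mul_const hUu (Or.inr (ENNReal.ofReal_ne_top (r := C))))
      (fun _ => zero_le) fun i => ?_
    calc ∫⁻ x in tsupport χ, ‖U i x * χ x - u x * χ x‖ₑ ∂μ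
        ≤ ∫⁻ x in tsupport χ, ‖U i x - u x‖ₑ * ENNReal.ofReal C ∂μ := by
          refine lintegral_mono fun x => ?_
          rw [← sub_mul, enorm_mul, ← ofReal_norm (χ x)]
          gcongr
          exact hC x
      _ = _ := lintegral_mul_const' _ _ ENNReal.ofReal_ne_top

end LocallyIntegrable

theorem exists_contDiff_eventuallyEq_one {E : Type*} [NormedAddCommGroup E]
    [NormedSpace ℝ E] [FiniteDimensional ℝ E] {Ω K : Set E} (hK : IsCompact K) (hΩ : IsOpen Ω)
    (hKΩ : K ⊆ Ω) :
    ∃ χ : E → ℝ, ContDiff ℝ ∞ χ ∧ HasCompactSupport χ ∧ tsupport χ ⊆ Ω ∧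
      ∀ x ∈ K, χ =ᶠ[𝓝 x] 1 := by
  obtain ⟨K', hK', hKK', hK'Ω⟩ := exists_compact_between hK hΩ hKΩ
  obtain ⟨χ, hχ1, hχ0, -⟩ := exists_contMDiffMap_one_nhds_of_subset_interior (n := ⊤) 𝓘(ℝ, E)
    hK.isClosed hKK'
  have hχK' : tsupport χ ⊆ K' :=
    closure_minimal (fun x hx => by_contra fun hxK' => hx (hχ0 x hxK')) hK'.isClosed
  exact ⟨χ, χ.contMDiff.contDiff, hK'.of_isClosed_subset (isClosed_tsupport _) hχK',
    hχK'.trans hK'Ω, fun x hx => hχ1.filter_mono (nhds_le_nhdsSet hx)⟩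

section Euclidean

variable {E : Type*} [NormedAddCommGroup E] [NormedSpace ℝ E] [MeasurableSpace E] {μ : Measure E}
  {Ω : Set E} {u h χ : E → ℝ} {v : E}

/-- `h` is the distributional derivative of `u` in the direction `v` on the open set `Ω`. No
integrability of `u` and `h` is built in: it is assumed where it is used. -/
def HasWeakDeriv (μ : Measure E) (Ω : Set E) (u h : E → ℝ) (v : E) : Prop :=
  ∀ η : E → ℝ, ContDiff ℝ ∞ η → HasCompactSupport η → tsupport η ⊆ Ω →
    ∫ y, u y * fderiv ℝ η y v ∂μ = - ∫ y, h y * η y ∂μ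

theorem HasWeakDeriv.of_forall_compact
    (H : ∀ K ⊆ Ω, IsCompact K → ∃ u' h', HasWeakDeriv μ univ u' h' v ∧ EqOn u' u K ∧ EqOn h' h K) :
    HasWeakDeriv μ Ω u h v := by
  intro η hη hηc hηΩ
  obtain ⟨u', h', hw, hu, hh⟩ := H _ hηΩ hηc
  convert hw η hη hηc (subset_univ _) using 2
  · ext x
    by_cases hx : x ∈ tsupport η
    · rw [hu hx]
    · rw [fderiv_of_notMem_tsupport ℝ hx]
      simp
  · congr 1
    ext x
    by_cases hx : x ∈ tsupport η
    · rw [hh hx]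
    · rw [image_eq_zero_of_notMem_tsupport hx, mul_zero, mul_zero]

theorem HasWeakDeriv.const_mul (hw : HasWeakDeriv μ Ω u h v) (c : ℝ) :
    HasWeakDeriv μ Ω (fun x => c * u x) (fun x => c * h x) v := by
  intro η hη hηc hηΩ
  simp only [mul_assoc, integral_const_mul, hw η hη hηc hηΩ, mul_neg]

section Borel

variable [BorelSpace E]

theorem integrable_mul_fderiv_of_tsupport_subset {η : E → ℝ} (hu : LocallyIntegrableOn u Ω μ)
    (hη : ContDiff ℝ 1 η) (hηc : HasCompactSupport η) (hηΩ : tsupport η ⊆ Ω) :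
    Integrable (fun y => u y * fderiv ℝ η y v) μ :=
  integrable_mul_of_tsupport_subset hu ((hη.continuous_fderiv one_ne_zero).clm_apply
    continuous_const) (hηc.fderiv_apply ℝ v) ((tsupport_fderiv_apply_subset ℝ v).trans hηΩ)

theorem HasWeakDeriv.add {u' h' : E → ℝ} (hu : LocallyIntegrableOn u Ω μ)
    (hu' : LocallyIntegrableOn u' Ω μ) (hh : LocallyIntegrableOn h Ω μ)
    (hh' : LocallyIntegrableOn h' Ω μ) (hw : HasWeakDeriv μ Ω u h v)
    (hw' : HasWeakDeriv μ Ω u' h' v) :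
    HasWeakDeriv μ Ω (fun x => u x + u' x) (fun x => h x + h' x) v := by
  intro η hη hηc hηΩ
  have hη₁ : ContDiff ℝ 1 η := hη.of_le (by simp)
  simp only [add_mul]
  rw [integral_add (integrable_mul_fderiv_of_tsupport_subset hu hη₁ hηc hηΩ)
      (integrable_mul_fderiv_of_tsupport_subset hu' hη₁ hηc hηΩ),
    integral_add (integrable_mul_of_tsupport_subset hh hη.continuous hηc hηΩ)
      (integrable_mul_of_tsupport_subset hh' hη.continuous hηc hηΩ),
    hw η hη hηc hηΩ, hw' η hη hηc hηΩ, neg_add]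

theorem HasWeakDeriv.of_tendsto {ι : Type*} {l : Filter ι} [l.NeBot] {U H : ι → E → ℝ}
    (hU : ∀ i, AEStronglyMeasurable (U i) (μ.restrict Ω))
    (hH : ∀ i, AEStronglyMeasurable (H i) (μ.restrict Ω))
    (hw : ∀ i, HasWeakDeriv μ Ω (U i) (H i) v)
    (hu : LocallyIntegrableOn u Ω μ) (hh : LocallyIntegrableOn h Ω μ)
    (hUu : ∀ K ⊆ Ω, IsCompact K → Tendsto (fun i => ∫⁻ x in K, ‖U i x - u x‖ₑ ∂μ) l (𝓝 0))
    (hHh : ∀ K ⊆ Ω, IsCompact K → Tendsto (fun i => ∫⁻ x in K, ‖H i x - h x‖ₑ ∂μ) l (𝓝 0)) :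
    HasWeakDeriv μ Ω u h v := by
  intro η hη hηc hηΩ
  have hη'Ω := (tsupport_fderiv_apply_subset ℝ (f := η) v).trans hηΩ
  have hη'c := hηc.fderiv_apply ℝ v
  have hlim := tendsto_integral_mul_of_tendsto_lintegral hη.continuous hηc
    (fun i => (hH i).mono_set hηΩ) (hh.integrableOn_compact_subset hηΩ hηc) (hHh _ hηΩ hηc)
  have hlim' := tendsto_integral_mul_of_tendsto_lintegral
    ((hη.continuous_fderiv (by simp)).clm_apply continuous_const) hη'c
    (fun i => (hU i).mono_set hη'Ω) (hu.integrableOn_compact_subset hη'Ω hη'c) (hUu _ hη'Ω hη'c)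
  simp only [fun i => hw i η hη hηc hηΩ] at hlim'
  exact tendsto_nhds_unique hlim' hlim.neg

theorem HasWeakDeriv.mul_contDiff (hu : LocallyIntegrableOn u Ω μ) (hh : LocallyIntegrableOn h Ω μ)
    (hw : HasWeakDeriv μ Ω u h v) (hχ : ContDiff ℝ ∞ χ) (hχc : HasCompactSupport χ)
    (hχΩ : tsupport χ ⊆ Ω) :
    HasWeakDeriv μ univ (fun x => u x * χ x) (fun x => h x * χ x + u x * fderiv ℝ χ x v) v := by
  intro ξ hξ _ _
  have hχ' : Continuous fun y => fderiv ℝ χ y v :=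
    (hχ.continuous_fderiv (by simp)).clm_apply continuous_const
  have hξ' : Continuous fun y => fderiv ℝ ξ y v :=
    (hξ.continuous_fderiv (by simp)).clm_apply continuous_const
  have hsub (f : E → ℝ) : tsupport (fun x => χ x * f x) ⊆ Ω := tsupport_mul_subset_left.trans hχΩ
  have hLeibniz (y : E) : fderiv ℝ (fun x => χ x * ξ x) y v =
      χ y * fderiv ℝ ξ y v + fderiv ℝ χ y v * ξ y := by
    rw [fderiv_fun_mul (hχ.differentiable (by simp) y) (hξ.differentiable (by simp) y)]
    simp [mul_comm]
  have i₁ : Integrable (fun y => u y * (χ y * fderiv ℝ ξ y v)) μ :=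
    integrable_mul_of_tsupport_subset hu (hχ.continuous.mul hξ') hχc.mul_right (hsub _)
  have i₂ : Integrable (fun y => u y * (fderiv ℝ χ y v * ξ y)) μ :=
    integrable_mul_of_tsupport_subset hu (hχ'.mul hξ.continuous) (hχc.fderiv_apply ℝ v).mul_right
      (tsupport_mul_subset_left.trans ((tsupport_fderiv_apply_subset ℝ v).trans hχΩ))
  have i₃ : Integrable (fun y => h y * (χ y * ξ y)) μ :=
    integrable_mul_of_tsupport_subset hh (hχ.continuous.mul hξ.continuous) hχc.mul_right (hsub _)
  have hχξ := hw (fun x => χ x * ξ x) (hχ.mul hξ) hχc.mul_right (hsub _)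
  simp only [hLeibniz, mul_add, integral_add i₁ i₂] at hχξ
  simp only [add_mul, mul_assoc, integral_add i₃ i₂]
  linarith

end Borel

theorem HasWeakDeriv.ae_unique [FiniteDimensional ℝ E] [BorelSpace E] {h' : E → ℝ}
    (hΩ : IsOpen Ω) (hh : LocallyIntegrableOn h Ω μ) (hh' : LocallyIntegrableOn h' Ω μ)
    (hw : HasWeakDeriv μ Ω u h v) (hw' : HasWeakDeriv μ Ω u h' v) :
    ∀ᵐ x ∂μ, x ∈ Ω → h x = h' x := by
  have hzero := hΩ.ae_eq_zero_of_integral_contDiff_smul_eq_zero (hh.sub hh')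
    fun η hη hηc hηΩ => by
      simp only [Pi.sub_apply, smul_eq_mul, mul_comm (η _), sub_mul]
      rw [integral_sub (integrable_mul_of_tsupport_subset hh hη.continuous hηc hηΩ)
        (integrable_mul_of_tsupport_subset hh' hη.continuous hηc hηΩ)]
      linarith [hw η hη hηc hηΩ, hw' η hη hηc hηΩ]
  filter_upwards [hzero] with x hx hxΩ
  exact sub_eq_zero.1 (hx hxΩ)

end Euclidean

section Mollification

open scoped Convolution
open ContinuousLinearMap (lsmul)

variable {E : Type*} [NormedAddCommGroup E] [NormedSpace ℝ E] [FiniteDimensional ℝ E]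
  [MeasurableSpace E] [BorelSpace E] {μ : Measure E} [μ.IsAddHaarMeasure] {u h : E → ℝ} {v : E}

theorem hasWeakDeriv_of_contDiff {Ω : Set E} (hu : ContDiff ℝ 1 u) :
    HasWeakDeriv μ Ω u (fun x => fderiv ℝ u x v) v := by
  intro η hη hηc _
  have hη1 : ContDiff ℝ 1 η := hη.of_le (by simp)
  have hu' : Continuous fun x => fderiv ℝ u x v :=
    (hu.continuous_fderiv one_ne_zero).clm_apply continuous_const
  have hloc {f : E → ℝ} (hf : Continuous f) : LocallyIntegrableOn f univ μ :=
    hf.continuousOn.locallyIntegrableOn MeasurableSet.univ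
  exact integral_mul_fderiv_eq_neg_fderiv_mul_of_integrable
    (integrable_mul_of_tsupport_subset (hloc hu') hη.continuous hηc (subset_univ _))
    (integrable_mul_fderiv_of_tsupport_subset (hloc hu.continuous) hη1 hηc (subset_univ _))
    (integrable_mul_of_tsupport_subset (hloc hu.continuous) hη.continuous hηc (subset_univ _))
    (fun x _ => hu.differentiable one_ne_zero x) (fun x _ => hη1.differentiable one_ne_zero x)

theorem tendsto_lintegral_translate_sub (hh : Integrable h μ) :
    Tendsto (fun z : E => ∫⁻ x, ‖h (x - z) - h x‖ₑ ∂μ) (𝓝 0) (𝓝 0) := by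
  have : Fact ((1 : ℝ≥0∞) ≤ 1) := ⟨le_rfl⟩
  have hL : MemLp h 1 μ := memLp_one_iff_integrable.2 hh
  let G (z : E) : C(E, E) := ⟨fun x => x - z, by fun_prop⟩
  have hG : Continuous G := ContinuousMap.continuous_of_continuous_uncurry _
    (continuous_snd.sub continuous_fst)
  have hGμ (z : E) : MeasurePreserving (G z) μ μ := measurePreserving_sub_right μ z
  have hlim : Tendsto (fun z => Lp.compMeasurePreserving (G z) (hGμ z) (hL.toLp h)) (𝓝 0)
      (𝓝 (Lp.compMeasurePreserving (G 0) (hGμ 0) (hL.toLp h))) :=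
    (continuous_const.compMeasurePreservingLp hG hGμ (by simp)).tendsto 0
  refine (tendsto_iff_edist_tendsto_0.1 hlim).congr fun z => ?_
  rw [Lp.edist_def, eLpNorm_one_eq_lintegral_enorm]
  refine lintegral_congr_ae ?_
  filter_upwards [Lp.coeFn_compMeasurePreserving (hL.toLp h) (hGμ 0),
    Lp.coeFn_compMeasurePreserving (hL.toLp h) (hGμ z),
    (hGμ z).quasiMeasurePreserving.ae_eq_comp hL.coeFn_toLp, hL.coeFn_toLp] with x h₀ hz hhz hh₀
  simp only [Function.comp_apply] at hhz
  have hG₀ : G 0 x = x := sub_zero x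
  rw [Pi.sub_apply, hz, h₀, Function.comp_apply, Function.comp_apply, hhz, hG₀, hh₀]
  rfl

theorem enorm_convolution_normed_sub_le (hh : LocallyIntegrable h μ) (φ : ContDiffBump (0 : E))
    (x : E) : ‖(φ.normed μ ⋆[lsmul ℝ ℝ, μ] h) x - h x‖ₑ ≤
      ∫⁻ z, ‖φ.normed μ z‖ₑ * ‖h (x - z) - h x‖ₑ ∂μ := by
  have hint : Integrable (fun z => φ.normed μ z * h (x - z)) μ :=
    (φ.hasCompactSupport_normed (μ := μ)).convolutionExists_left (lsmul ℝ ℝ)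
      φ.continuous_normed hh x
  have heq : (φ.normed μ ⋆[lsmul ℝ ℝ, μ] h) x - h x =
      ∫ z, φ.normed μ z * (h (x - z) - h x) ∂μ := by
    simp_rw [mul_sub]
    rw [integral_sub hint (φ.integrable_normed.mul_const _), integral_mul_const,
      φ.integral_normed, one_mul]
    rfl
  simpa only [heq, enorm_mul] using enorm_integral_le_lintegral_enorm (μ := μ)
    (fun z => φ.normed μ z * (h (x - z) - h x))

theorem lintegral_convolution_normed_sub_le (hh : Integrable h μ) (φ : ContDiffBump (0 : E))
    {c : ℝ≥0∞} (hc : ∀ z ∈ Metric.ball (0 : E) φ.rOut, ∫⁻ x, ‖h (x - z) - h x‖ₑ ∂μ ≤ c) :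
    ∫⁻ x, ‖(φ.normed μ ⋆[lsmul ℝ ℝ, μ] h) x - h x‖ₑ ∂μ ≤ c := by
  have hmeas : AEMeasurable (Function.uncurry fun x z => ‖φ.normed μ z‖ₑ * ‖h (x - z) - h x‖ₑ)
      (μ.prod μ) :=
    (φ.continuous_normed.comp continuous_snd).aestronglyMeasurable.enorm.mul
      ((hh.1.comp_quasiMeasurePreserving (quasiMeasurePreserving_sub μ μ)).sub
        hh.1.comp_fst).enorm
  have hone : ∫⁻ z, ‖φ.normed μ z‖ₑ ∂μ = 1 := by
    rw [← ofReal_integral_norm_eq_lintegral_enorm φ.integrable_normed]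
    simp [abs_of_nonneg (φ.nonneg_normed _), φ.integral_normed]
  calc ∫⁻ x, ‖(φ.normed μ ⋆[lsmul ℝ ℝ, μ] h) x - h x‖ₑ ∂μ
      ≤ ∫⁻ x, ∫⁻ z, ‖φ.normed μ z‖ₑ * ‖h (x - z) - h x‖ₑ ∂μ ∂μ :=
        lintegral_mono (enorm_convolution_normed_sub_le hh.locallyIntegrable φ)
    _ = ∫⁻ z, ‖φ.normed μ z‖ₑ * ∫⁻ x, ‖h (x - z) - h x‖ₑ ∂μ ∂μ := by
        rw [lintegral_lintegral_swap hmeas]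
        exact lintegral_congr fun z => lintegral_const_mul' _ _ enorm_ne_top
    _ ≤ ∫⁻ z, ‖φ.normed μ z‖ₑ * c ∂μ := by
        refine lintegral_mono fun z => ?_
        by_cases hz : z ∈ Function.support (φ.normed μ)
        · exact mul_le_mul_right (hc z (φ.support_normed_eq (μ := μ) ▸ hz)) _
        · simp [Function.notMem_support.1 hz]
    _ = c := by
        rw [lintegral_mul_const'' _ φ.integrable_normed.aestronglyMeasurable.enorm, hone, one_mul]

theorem tendsto_lintegral_convolution_normed_sub (hh : Integrable h μ)
    {φ : ℕ → ContDiffBump (0 : E)} (hφ : Tendsto (fun k => (φ k).rOut) atTop (𝓝 0)) :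
    Tendsto (fun k => ∫⁻ x, ‖((φ k).normed μ ⋆[lsmul ℝ ℝ, μ] h) x - h x‖ₑ ∂μ) atTop (𝓝 0) := by
  rw [ENNReal.tendsto_nhds_zero]
  intro c hc
  obtain ⟨r, hr, hrc⟩ := Metric.eventually_nhds_iff_ball.1
    (ENNReal.tendsto_nhds_zero.1 (tendsto_lintegral_translate_sub hh) c hc)
  filter_upwards [hφ.eventually (gt_mem_nhds hr)] with k hk
  exact lintegral_convolution_normed_sub_le hh (φ k)
    fun z hz => hrc z (Metric.ball_subset_ball hk.le hz)

theorem HasWeakDeriv.fderiv_convolution (hu : LocallyIntegrable u μ)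
    (hw : HasWeakDeriv μ univ u h v) (φ : ContDiffBump (0 : E)) (x : E) :
    fderiv ℝ (φ.normed μ ⋆[lsmul ℝ ℝ, μ] u) x v = (φ.normed μ ⋆[lsmul ℝ ℝ, μ] h) x := by
  have hφ : ContDiff ℝ 1 (φ.normed μ) := φ.contDiff_normed
  have hφc : HasCompactSupport (φ.normed μ) := φ.hasCompactSupport_normed
  have hφ' (y : E) : fderiv ℝ (fun y => φ.normed μ (x - y)) y v =
      - fderiv ℝ (φ.normed μ) (x - y) v := by
    have hd := (hφ.differentiable one_ne_zero (x - y)).hasFDerivAt.comp y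
      ((hasFDerivAt_id y).const_sub x)
    rw [show (fun y => φ.normed μ (x - y)) = φ.normed μ ∘ fun y => x - y from rfl, hd.fderiv]
    simp
  have htest := hw (fun y => φ.normed μ (x - y))
    (φ.contDiff_normed.comp (contDiff_const.sub contDiff_id))
    (hφc.comp_homeomorph (Homeomorph.subLeft x)) (subset_univ _)
  simp only [hφ', mul_neg, integral_neg, neg_inj] at htest
  have hint := (hφc.fderiv ℝ).convolutionExists_left ((lsmul ℝ ℝ).precompL E)
    (hφ.continuous_fderiv one_ne_zero) hu x
  calc fderiv ℝ (φ.normed μ ⋆[lsmul ℝ ℝ, μ] u) x v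
      = ∫ t, fderiv ℝ (φ.normed μ) t v * u (x - t) ∂μ := by
        rw [(hφc.hasFDerivAt_convolution_left (lsmul ℝ ℝ) hφ hu x).fderiv, convolution_def,
          ContinuousLinearMap.integral_apply hint]
        simp [ContinuousLinearMap.precompL_apply]
    _ = ∫ y, u y * fderiv ℝ (φ.normed μ) (x - y) v ∂μ := by
        rw [← integral_sub_left_eq_self _ μ x]
        simp only [sub_sub_cancel, mul_comm]
    _ = ∫ y, h y * φ.normed μ (x - y) ∂μ := htest
    _ = (φ.normed μ ⋆[lsmul ℝ ℝ, μ] h) x := by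
        rw [convolution_def, ← integral_sub_left_eq_self _ μ x]
        simp [mul_comm]

theorem HasWeakDeriv.exists_contDiff_tendsto (hu : Integrable u μ) (hh : Integrable h μ)
    (hw : HasWeakDeriv μ univ u h v) :
    ∃ U : ℕ → E → ℝ, (∀ k, ContDiff ℝ 1 (U k)) ∧
      (∀ᵐ x ∂μ, Tendsto (fun k => U k x) atTop (𝓝 (u x))) ∧
      Tendsto (fun k => ∫⁻ x, ‖U k x - u x‖ₑ ∂μ) atTop (𝓝 0) ∧
      Tendsto (fun k => ∫⁻ x, ‖fderiv ℝ (U k) x v - h x‖ₑ ∂μ) atTop (𝓝 0) := by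
  let φ (k : ℕ) : ContDiffBump (0 : E) :=
    { rIn := 1 / ((k : ℝ) + 1), rOut := 2 * (1 / ((k : ℝ) + 1)), rIn_pos := by positivity
      rIn_lt_rOut := lt_mul_of_one_lt_left (by positivity) one_lt_two }
  have hφ : Tendsto (fun k => (φ k).rOut) atTop (𝓝 0) := by
    simpa [φ] using (tendsto_one_div_add_atTop_nhds_zero_nat (𝕜 := ℝ)).const_mul 2
  refine ⟨fun k => (φ k).normed μ ⋆[lsmul ℝ ℝ, μ] u, fun k => ?_, ?_,
    tendsto_lintegral_convolution_normed_sub hu hφ, ?_⟩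
  · exact (φ k).hasCompactSupport_normed.contDiff_convolution_left (lsmul ℝ ℝ)
      (φ k).contDiff_normed hu.locallyIntegrable
  · exact ContDiffBump.ae_convolution_tendsto_right_of_locallyIntegrable (K := 2) hφ
      (Eventually.of_forall fun k => le_rfl) hu.locallyIntegrable
  · simpa only [hw.fderiv_convolution hu.locallyIntegrable] using
      tendsto_lintegral_convolution_normed_sub hh hφ

end Mollification

section ChainRule

open scoped NNReal

variable {E : Type*} [NormedAddCommGroup E] [NormedSpace ℝ E] [FiniteDimensional ℝ E]
  [MeasurableSpace E] [BorelSpace E] {μ : Measure E} [μ.IsAddHaarMeasure] {Ω : Set E}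
  {u h : E → ℝ} {v : E}

theorem tendsto_lintegral_enorm_sub_of_dominated {X : Type*} [MeasurableSpace X] {ν : Measure X}
    {f : X → ℝ} {F : ℕ → X → ℝ} {G : X → ℝ} (hF : ∀ k, AEStronglyMeasurable (F k) ν)
    (hG : Integrable G ν) (hFG : ∀ k x, |F k x| ≤ G x)
    (hlim : ∀ᵐ x ∂ν, Tendsto (fun k => F k x) atTop (𝓝 (f x))) :
    Tendsto (fun k => ∫⁻ x, ‖F k x - f x‖ₑ ∂ν) atTop (𝓝 0) := by
  simpa only [ofReal_norm] using tendsto_lintegral_norm_of_dominated_convergence hF hG.2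
    (fun k => ae_of_all _ (hFG k)) hlim

theorem tendsto_lintegral_mul_sub_of_bounded {X : Type*} [MeasurableSpace X] {ν : Measure X}
    {h a : X → ℝ} {H A : ℕ → X → ℝ} {C : ℝ≥0} (hA : ∀ k, AEStronglyMeasurable (A k) ν)
    (hH : ∀ k, AEStronglyMeasurable (H k) ν) (hh : Integrable h ν) (hAC : ∀ k x, ‖A k x‖₊ ≤ C)
    (hAa : ∀ᵐ x ∂ν, Tendsto (fun k => A k x) atTop (𝓝 (a x)))
    (hHh : Tendsto (fun k => ∫⁻ x, ‖H k x - h x‖ₑ ∂ν) atTop (𝓝 0)) :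
    Tendsto (fun k => ∫⁻ x, ‖A k x * H k x - a x * h x‖ₑ ∂ν) atTop (𝓝 0) := by
  have hdom : Tendsto (fun k => ∫⁻ x, ‖A k x * h x - a x * h x‖ₑ ∂ν) atTop (𝓝 0) := by
    refine tendsto_lintegral_enorm_sub_of_dominated (G := fun x => C * |h x|)
      (fun k => (hA k).mul hh.1) (hh.abs.const_mul _) (fun k x => ?_) ?_
    · rw [abs_mul]
      exact mul_le_mul_of_nonneg_right (hAC k x) (abs_nonneg _)
    · filter_upwards [hAa] with x hx using hx.mul_const _
  have hsum : Tendsto (fun k => C * ∫⁻ x, ‖H k x - h x‖ₑ ∂ν + ∫⁻ x, ‖A k x * h x - a x * h x‖ₑ ∂ν)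
      atTop (𝓝 0) := by
    simpa using (ENNReal.Tendsto.const_mul hHh (Or.inr ENNReal.coe_ne_top)).add hdom
  refine tendsto_of_tendsto_of_tendsto_of_le_of_le tendsto_const_nhds hsum
    (fun _ => zero_le) fun k => ?_
  calc ∫⁻ x, ‖A k x * H k x - a x * h x‖ₑ ∂ν
      ≤ ∫⁻ x, C * ‖H k x - h x‖ₑ + ‖A k x * h x - a x * h x‖ₑ ∂ν := by
        refine lintegral_mono fun x => ?_
        calc ‖A k x * H k x - a x * h x‖ₑ
            = ‖A k x * (H k x - h x) + (A k x * h x - a x * h x)‖ₑ := by ring_nf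
          _ ≤ ‖A k x‖ₑ * ‖H k x - h x‖ₑ + ‖A k x * h x - a x * h x‖ₑ :=
            (enorm_add_le _ _).trans_eq (by rw [enorm_mul])
          _ ≤ C * ‖H k x - h x‖ₑ + ‖A k x * h x - a x * h x‖ₑ := by
            gcongr
            exact ENNReal.coe_le_coe.2 (hAC k x)
    _ = C * ∫⁻ x, ‖H k x - h x‖ₑ ∂ν + ∫⁻ x, ‖A k x * h x - a x * h x‖ₑ ∂ν := by
        have hmeas : AEMeasurable (fun x => C * ‖H k x - h x‖ₑ) ν :=
          ((hH k).sub hh.1).enorm.const_mul _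
        rw [lintegral_add_left' hmeas, lintegral_const_mul' _ _ ENNReal.coe_ne_top]

theorem locallyIntegrable_comp_of_lipschitzWith {X : Type*} [TopologicalSpace X]
    [MeasurableSpace X] {ν : Measure X} [IsLocallyFiniteMeasure ν] {F : ℝ → ℝ} {C : ℝ≥0}
    {u : X → ℝ} (hF : LipschitzWith C F) (hu : Integrable u ν) :
    LocallyIntegrable (fun x => F (u x)) ν := by
  refine ((locallyIntegrable_const |F 0|).add (hu.abs.const_mul C).locallyIntegrable).mono
    (hF.continuous.comp_aestronglyMeasurable hu.1) (ae_of_all _ fun x => ?_)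
  have hFx : |F (u x) - F 0| ≤ C * |u x - 0| := hF.dist_le_mul _ _
  rw [sub_zero] at hFx
  calc |F (u x)| ≤ |F 0| + C * |u x| := by linarith [abs_sub_abs_le_abs_sub (F (u x)) (F 0)]
    _ ≤ ‖|F 0| + C * |u x|‖ := le_abs_self _

theorem HasWeakDeriv.comp_of_integrable {F : ℝ → ℝ} {C : ℝ≥0} (hF : ContDiff ℝ 1 F)
    (hFC : LipschitzWith C F) (hu : Integrable u μ) (hh : Integrable h μ)
    (hw : HasWeakDeriv μ univ u h v) :
    HasWeakDeriv μ univ (fun x => F (u x)) (fun x => deriv F (u x) * h x) v := by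
  obtain ⟨U, hU, hUae, hUu, hUh⟩ := hw.exists_contDiff_tendsto hu hh
  have hF' : Continuous (deriv F) := hF.continuous_deriv le_rfl
  have hF'C (t : ℝ) : ‖deriv F t‖ ≤ C := norm_deriv_le_of_lipschitz hFC
  have hUc (k : ℕ) : Continuous (U k) := (hU k).continuous
  have hU' (k : ℕ) : Continuous fun x => fderiv ℝ (U k) x v :=
    ((hU k).continuous_fderiv one_ne_zero).clm_apply continuous_const
  have hchain (k : ℕ) : HasWeakDeriv μ univ (fun x => F (U k x))
      (fun x => deriv F (U k x) * fderiv ℝ (U k) x v) v := by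
    have hfderiv (x : E) :
        fderiv ℝ (fun x => F (U k x)) x v = deriv F (U k x) * fderiv ℝ (U k) x v := by
      rw [fderiv_fun_comp x (hF.differentiable one_ne_zero _) ((hU k).differentiable one_ne_zero _)]
      simp [mul_comm]
    simp only [← hfderiv]
    exact hasWeakDeriv_of_contDiff (hF.comp (hU k))
  have hFu : LocallyIntegrable (fun x => F (u x)) μ :=
    locallyIntegrable_comp_of_lipschitzWith hFC hu
  have hF'h : Integrable (fun x => deriv F (u x) * h x) μ :=
    hh.bdd_mul (hF'.comp_aestronglyMeasurable hu.1) (ae_of_all _ fun x => hF'C (u x))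
  have hmono {f : E → ℝ≥0∞} (K : Set E) : ∫⁻ x in K, f x ∂μ ≤ ∫⁻ x, f x ∂μ :=
    setLIntegral_le_lintegral K f
  refine .of_tendsto (l := atTop) (fun k => (hF.continuous.comp (hUc k)).aestronglyMeasurable)
    (fun k => ((hF'.comp (hUc k)).mul (hU' k)).aestronglyMeasurable) hchain
    (hFu.locallyIntegrableOn univ) (hF'h.locallyIntegrable.locallyIntegrableOn univ)
    (fun K _ _ => ?_) (fun K _ _ => ?_)
  · refine tendsto_of_tendsto_of_tendsto_of_le_of_le tendsto_const_nhds
      (by simpa using ENNReal.Tendsto.const_mul hUu (Or.inr (ENNReal.coe_ne_top (r := C))))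
      (fun _ => zero_le) fun k => (hmono K).trans ?_
    rw [← lintegral_const_mul' _ _ ENNReal.coe_ne_top]
    refine lintegral_mono fun x => ?_
    simpa only [edist_eq_enorm_sub, Function.comp_apply] using hFC (U k x) (u x)
  · exact tendsto_of_tendsto_of_tendsto_of_le_of_le tendsto_const_nhds
      (tendsto_lintegral_mul_sub_of_bounded (fun k => (hF'.comp (hUc k)).aestronglyMeasurable)
        (fun k => (hU' k).aestronglyMeasurable) hh (fun k x => hF'C (U k x))
        (hUae.mono fun x hx => (hF'.tendsto _).comp hx) hUh)
      (fun _ => zero_le) fun k => hmono K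

theorem HasWeakDeriv.comp (hΩ : IsOpen Ω) {F : ℝ → ℝ} {C : ℝ≥0} (hF : ContDiff ℝ 1 F)
    (hFC : LipschitzWith C F) (hu : LocallyIntegrableOn u Ω μ) (hh : LocallyIntegrableOn h Ω μ)
    (hw : HasWeakDeriv μ Ω u h v) :
    HasWeakDeriv μ Ω (fun x => F (u x)) (fun x => deriv F (u x) * h x) v := by
  refine .of_forall_compact fun K hKΩ hK => ?_
  obtain ⟨χ, hχ, hχc, hχΩ, hχK⟩ := exists_contDiff_eventuallyEq_one hK hΩ hKΩ
  have hχ' {x : E} (hx : x ∈ K) : fderiv ℝ χ x v = 0 := by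
    rw [(hχK x hx).fderiv_eq]
    simp
  refine ⟨_, _, (hw.mul_contDiff hu hh hχ hχc hχΩ).comp_of_integrable hF hFC
    (integrable_mul_of_tsupport_subset hu hχ.continuous hχc hχΩ)
    ((integrable_mul_of_tsupport_subset hh hχ.continuous hχc hχΩ).add
      (integrable_mul_fderiv_of_tsupport_subset hu (hχ.of_le (by simp)) hχc hχΩ)),
    fun x hx => ?_, fun x hx => ?_⟩
  · simp [(hχK x hx).eq_of_nhds]
  · simp [(hχK x hx).eq_of_nhds, hχ' hx]

theorem hasDerivAt_sqrt_sq_add {δ : ℝ} (hδ : 0 < δ) (t : ℝ) :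
    HasDerivAt (fun t => √(t ^ 2 + δ)) (t / √(t ^ 2 + δ)) t := by
  convert ((hasDerivAt_pow 2 t).add_const δ).sqrt (by positivity) using 1
  simp
  field_simp

theorem continuous_div_sqrt_sq_add {δ : ℝ} (hδ : 0 < δ) :
    Continuous fun t : ℝ => t / √(t ^ 2 + δ) :=
  continuous_id.div (by fun_prop) fun t => by positivity

theorem abs_div_sqrt_sq_add_le_one {δ : ℝ} (hδ : 0 ≤ δ) (t : ℝ) : |t / √(t ^ 2 + δ)| ≤ 1 := by
  rw [abs_div, abs_of_nonneg (Real.sqrt_nonneg _)]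
  exact div_le_one_of_le₀ (Real.abs_le_sqrt (le_add_of_nonneg_right hδ)) (Real.sqrt_nonneg _)

theorem tendsto_div_sqrt_sq_add {ι : Type*} {l : Filter ι} {δ : ι → ℝ} (hδ : Tendsto δ l (𝓝 0))
    (t : ℝ) : Tendsto (fun k => t / √(t ^ 2 + δ k)) l (𝓝 (SignType.sign t)) := by
  rcases eq_or_ne t 0 with rfl | ht
  · simp only [zero_div, sign_zero, SignType.coe_zero, tendsto_const_nhds]
  · have hsign : (SignType.sign t : ℝ) = t / √(t ^ 2 + 0) := by
      rw [add_zero, Real.sqrt_sq_eq_abs, eq_div_iff (abs_ne_zero.2 ht), sign_mul_abs]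
    rw [hsign]
    exact tendsto_const_nhds.div (hδ.const_add _).sqrt (by positivity)

theorem measurable_coe_sign : Measurable fun t : ℝ => (SignType.sign t : ℝ) :=
  measurable_of_tendsto_metrizable
    (fun k : ℕ => (continuous_div_sqrt_sq_add (by positivity : 0 < 1 / ((k : ℝ) + 1))).measurable)
    (tendsto_pi_nhds.2 (tendsto_div_sqrt_sq_add tendsto_one_div_add_atTop_nhds_zero_nat))

theorem locallyIntegrableOn_sign_mul {X : Type*} [TopologicalSpace X] [LocallyCompactSpace X]
    [MeasurableSpace X] {ν : Measure X} {Ω : Set X} {u h : X → ℝ} (hΩ : IsOpen Ω)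
    (hu : AEStronglyMeasurable u (ν.restrict Ω))
    (hh : LocallyIntegrableOn h Ω ν) :
    LocallyIntegrableOn (fun x => SignType.sign (u x) * h x) Ω ν := by
  rw [locallyIntegrableOn_iff hΩ.isLocallyClosed] at hh ⊢
  refine fun K hKΩ hK => (hh K hKΩ hK).bdd_mul (c := 1) ?_ (ae_of_all _ fun x => ?_)
  · exact measurable_coe_sign.stronglyMeasurable.aestronglyMeasurable.comp_aemeasurable
      (hu.mono_set hKΩ).aemeasurable
  · rcases lt_trichotomy (u x) 0 with hx | hx | hx <;> simp [hx]

theorem HasWeakDeriv.abs (hΩ : IsOpen Ω) (hu : LocallyIntegrableOn u Ω μ)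
    (hh : LocallyIntegrableOn h Ω μ) (hw : HasWeakDeriv μ Ω u h v) :
    HasWeakDeriv μ Ω (fun x => |u x|) (fun x => SignType.sign (u x) * h x) v := by
  let δ (k : ℕ) : ℝ := 1 / ((k : ℝ) + 1)
  have hδ (k : ℕ) : 0 < δ k := by positivity
  have hδ₁ (k : ℕ) : δ k ≤ 1 := div_le_one_of_le₀ (by simp) (by positivity)
  have hδ₀ : Tendsto δ atTop (𝓝 0) := tendsto_one_div_add_atTop_nhds_zero_nat
  have hderiv (k : ℕ) : deriv (fun t => √(t ^ 2 + δ k)) = fun t => t / √(t ^ 2 + δ k) :=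
    deriv_eq (hasDerivAt_sqrt_sq_add (hδ k))
  have hcont (k : ℕ) : Continuous fun t : ℝ => √(t ^ 2 + δ k) := by fun_prop
  have hw' (k : ℕ) : HasWeakDeriv μ Ω (fun x => √(u x ^ 2 + δ k))
      (fun x => u x / √(u x ^ 2 + δ k) * h x) v := by
    have hF : ContDiff ℝ 1 fun t => √(t ^ 2 + δ k) := by
      have := hδ k
      exact ((contDiff_id.pow 2).add contDiff_const).sqrt fun t => by positivity
    have hF₁ : LipschitzWith 1 fun t => √(t ^ 2 + δ k) :=
      lipschitzWith_of_nnnorm_deriv_le (hF.differentiable one_ne_zero) fun t => by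
        rw [hderiv]
        exact abs_div_sqrt_sq_add_le_one (hδ k).le t
    simpa only [hderiv] using hw.comp hΩ hF hF₁ hu hh
  have hum : AEStronglyMeasurable u (μ.restrict Ω) := hu.aestronglyMeasurable
  have hdiv (k : ℕ) := (continuous_div_sqrt_sq_add (hδ k)).comp_aestronglyMeasurable hum
  refine .of_tendsto (l := atTop) (fun k => (hcont k).comp_aestronglyMeasurable hum)
    (fun k => (hdiv k).mul hh.aestronglyMeasurable) hw' hu.norm
    (locallyIntegrableOn_sign_mul hΩ hum hh) (fun K hKΩ hK => ?_) (fun K hKΩ hK => ?_)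
  · refine tendsto_lintegral_enorm_sub_of_dominated (G := fun x => |u x| + 1)
      (fun k => (hcont k).comp_aestronglyMeasurable (hum.mono_set hKΩ))
      ((hu.integrableOn_compact_subset hKΩ hK).abs.add (integrableOn_const hK.measure_ne_top))
      (fun k x => ?_) (ae_of_all _ fun x => ?_)
    · rw [abs_of_nonneg (Real.sqrt_nonneg _), Real.sqrt_le_left (by positivity)]
      nlinarith [hδ₁ k, sq_abs (u x), abs_nonneg (u x)]
    · rw [← Real.sqrt_sq_eq_abs]
      simpa only [add_zero] using (hδ₀.const_add (u x ^ 2)).sqrt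
  · exact tendsto_lintegral_mul_sub_of_bounded (C := 1) (fun k => (hdiv k).mono_set hKΩ)
      (fun _ => hh.aestronglyMeasurable.mono_set hKΩ) (hh.integrableOn_compact_subset hKΩ hK)
      (fun k x => abs_div_sqrt_sq_add_le_one (hδ k).le (u x))
      (ae_of_all _ fun x => tendsto_div_sqrt_sq_add hδ₀ (u x)) (by simp)

end ChainRule

theorem iSup_measure_eq_zero {α : Type*} {ι : Sort*} [MeasurableSpace α] {μ : ι → Measure α}
    {s : Set α} (hs : MeasurableSet s) (h : ∀ i, μ i s = 0) : (⨆ i, μ i) s = 0 := by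
  have hle : ⨆ i, μ i ≤ (⨆ i, μ i).restrict sᶜ := iSup_le fun i =>
    (Measure.restrict_eq_self_of_ae_mem (measure_eq_zero_iff_ae_notMem.1 (h i))).ge.trans
      (Measure.restrict_mono_measure (le_iSup μ i) _)
  refine le_antisymm ((hle s).trans_eq ?_) zero_le
  rw [Measure.restrict_apply hs, inter_compl_self, measure_empty]

theorem aemeasurable_chart_symm {X Y : Type*} [TopologicalSpace X]
    [MeasurableSpace X] [BorelSpace X] [TopologicalSpace Y] [MeasurableSpace Y] [BorelSpace Y]
    (e : OpenPartialHomeomorph X Y) (μ : Measure Y) :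
    AEMeasurable e.symm (μ.restrict e.target) :=
  e.continuousOn_symm.aemeasurable e.open_target.measurableSet

theorem exists_measurable_eqOn_chart {X Y : Type*} [TopologicalSpace X]
    [MeasurableSpace X] [BorelSpace X] [TopologicalSpace Y] [MeasurableSpace Y] [BorelSpace Y]
    [Nonempty Y]
    (e : OpenPartialHomeomorph X Y) :
    ∃ f : X → Y, Measurable f ∧ EqOn f e e.source := by
  classical
  exact ⟨e.source.piecewise e fun _ => Classical.arbitrary Y,
    e.continuousOn.measurable_piecewise continuousOn_const e.open_source.measurableSet,
    piecewise_eqOn _ _ _⟩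

section Charts

variable {n : ℕ} {N : Type*} [TopologicalSpace N] [ChartedSpace (Model n) N]
  {e : OpenPartialHomeomorph N (Model n)}

theorem mfderiv_symm_eq_sum (e : OpenPartialHomeomorph N (Model n)) (y z : Model n) :
    mfderiv (𝓡 (n + 1)) (𝓡 (n + 1)) e.symm y z = ∑ i, z i • coordVec e y i := by
  have hz : z = ∑ i, z i • EuclideanSpace.single i (1 : ℝ) := by
    simpa using ((EuclideanSpace.basisFun (Fin (n + 1)) ℝ).sum_repr z).symm
  conv_lhs => rw [hz]
  exact (map_sum (mfderiv (𝓡 (n + 1)) (𝓡 (n + 1)) e.symm y) _ _).trans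
    (Finset.sum_congr rfl fun i _ => map_smul (mfderiv (𝓡 (n + 1)) (𝓡 (n + 1)) e.symm y) (z i) _)

theorem mdifferentiable_of_mem_charts (he : e ∈ charts n N) :
    e.MDifferentiable (𝓡 (n + 1)) (𝓡 (n + 1)) :=
  ⟨(contMDiffOn_of_mem_maximalAtlas he).mdifferentiableOn (by simp),
    (contMDiffOn_symm_of_mem_maximalAtlas he).mdifferentiableOn (by simp)⟩

theorem differentiableOn_transition {e' : OpenPartialHomeomorph N (Model n)}
    (he : e ∈ charts n N) (he' : e' ∈ charts n N) :
    DifferentiableOn ℝ (e' ∘ e.symm) (e.target ∩ e.symm ⁻¹' e'.source) := by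
  have h : ContMDiffOn (𝓡 (n + 1)) (𝓡 (n + 1)) ∞ (e' ∘ e.symm)
      (e.target ∩ e.symm ⁻¹' e'.source) :=
    (contMDiffOn_of_mem_maximalAtlas he').comp
      ((contMDiffOn_symm_of_mem_maximalAtlas he).mono inter_subset_left) fun y hy => hy.2
  exact (contMDiffOn_iff_contDiffOn.1 h).differentiableOn (by simp)

theorem sum_coords_smul_coordVec (he : e ∈ charts n N)
    (X : (x : N) → TangentSpace (𝓡 (n + 1)) x) {y : Model n} (hy : y ∈ e.target) :
    ∑ i, coords e X y i • coordVec e y i = X (e.symm y) := by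
  have hcomp := (mdifferentiable_of_mem_charts he).symm_comp_deriv (e.map_target hy)
  rw [e.right_inv hy] at hcomp
  rw [← mfderiv_symm_eq_sum]
  exact congrArg (fun L => L (X (e.symm y))) hcomp

theorem linearIndependent_coordVec (he : e ∈ charts n N) {y : Model n} (hy : y ∈ e.target) :
    LinearIndependent ℝ (coordVec e y) := by
  refine Fintype.linearIndependent_iff.2 fun c hc i => ?_
  have hcomp := congrArg (fun L => L (WithLp.toLp 2 c : Model n))
    ((mdifferentiable_of_mem_charts he).comp_symm_deriv hy)
  have hc' : mfderiv (𝓡 (n + 1)) (𝓡 (n + 1)) e.symm y (WithLp.toLp 2 c : Model n) = 0 :=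
    (mfderiv_symm_eq_sum e y _).trans hc
  have hc₀ : mfderiv (𝓡 (n + 1)) (𝓡 (n + 1)) e (e.symm y)
      (mfderiv (𝓡 (n + 1)) (𝓡 (n + 1)) e.symm y (WithLp.toLp 2 c : Model n)) = 0 := by
    rw [hc', map_zero]
  exact congrArg (fun z : Model n => z i) (hcomp.symm.trans hc₀)

theorem aestronglyMeasurable_clm_apply_chart {X : (x : N) → TangentSpace (𝓡 (n + 1)) x}
    {L : (y : Model n) → TangentSpace (𝓡 (n + 1)) (e.symm y) →L[ℝ] ℝ} (he : e ∈ charts n N)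
    (hX : AEStronglyMeasurable (coords e X) (volume.restrict e.target))
    (hL : ∀ i, AEStronglyMeasurable (fun y => L y (coordVec e y i)) (volume.restrict e.target)) :
    AEStronglyMeasurable (fun y => L y (X (e.symm y))) (volume.restrict e.target) := by
  have hsum : AEStronglyMeasurable (fun y => ∑ i, coords e X y i * L y (coordVec e y i))
      (volume.restrict e.target) :=
    Finset.aestronglyMeasurable_fun_sum _ fun i _ => .mul
      ((by fun_prop : Continuous fun z : Model n => z i).comp_aestronglyMeasurable hX) (hL i)
  refine hsum.congr ((ae_restrict_iff' e.open_target.measurableSet).2 (ae_of_all _ fun y hy => ?_))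
  simpa only [map_sum, map_smul, smul_eq_mul] using
    congrArg (L y) (sum_coords_smul_coordVec he X hy)

variable [IsManifold (𝓡 (n + 1)) ∞ N]

theorem contMDiffOn_coordVec (he : e ∈ charts n N) (i : Fin (n + 1)) :
    ContMDiffOn (𝓡 (n + 1)) ((𝓡 (n + 1)).prod 𝓘(ℝ, Model n)) 0
      (fun y => (Bundle.TotalSpace.mk' (Model n) (e.symm y) (coordVec e y i) :
        TangentBundle (𝓡 (n + 1)) N)) e.target := by
  have htangentMap := (contMDiffOn_symm_of_mem_maximalAtlas he).contMDiffOn_tangentMapWithin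
    (m := 0) (by simp) e.open_target.uniqueMDiffOn
  have hsingle : ContMDiffOn (𝓡 (n + 1)) ((𝓡 (n + 1)).prod 𝓘(ℝ, Model n)) 0
      (fun y => (⟨y, (EuclideanSpace.single i (1 : ℝ) : Model n)⟩ :
        TangentBundle (𝓡 (n + 1)) (Model n))) e.target :=
    contMDiffOn_vectorSpace_iff_contDiffOn.2 contDiffOn_const
  refine (htangentMap.comp hsingle fun y hy => hy).congr fun y hy => ?_
  simp only [Function.comp_apply, tangentMapWithin, coordVec]
  rw [mfderivWithin_of_isOpen e.open_target hy]

variable (g : SmoothMetric n N)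

theorem metric_self_nonneg (x : N) (v : TangentSpace (𝓡 (n + 1)) x) : 0 ≤ g.inner x v v := by
  rcases eq_or_ne v 0 with rfl | h
  · simp
  · exact (g.pos x v h).le

theorem two_mul_abs_metric_le (x : N) (v w : TangentSpace (𝓡 (n + 1)) x) :
    2 * |g.inner x v w| ≤ g.inner x v v + g.inner x w w := by
  have hadd := metric_self_nonneg g x (v + w)
  have hsub := metric_self_nonneg g x (v - w)
  simp only [map_add, map_sub, add_apply, sub_apply, g.symm x w v] at hadd hsub
  have : |g.inner x v w| ≤ (g.inner x v v + g.inner x w w) / 2 :=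
    abs_le.2 ⟨by linarith, by linarith⟩
  linarith

theorem metric_add_self_le (x : N) (v w : TangentSpace (𝓡 (n + 1)) x) :
    g.inner x (v + w) (v + w) ≤ 2 * g.inner x v v + 2 * g.inner x w w := by
  have hvw := two_mul_abs_metric_le g x v w
  have hle := le_abs_self (g.inner x v w)
  simp only [map_add, add_apply, g.symm x w v]
  linarith

theorem continuousOn_metric_coordVec (he : e ∈ charts n N) (i j : Fin (n + 1)) :
    ContinuousOn (fun y => g.inner (e.symm y) (coordVec e y i) (coordVec e y j)) e.target := by
  have hg : ContMDiffOn (𝓡 (n + 1)) ((𝓡 (n + 1)).prod 𝓘(ℝ, Model n →L[ℝ] Model n →L[ℝ] ℝ)) 0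
      (fun y => (Bundle.TotalSpace.mk' (Model n →L[ℝ] Model n →L[ℝ] ℝ)
        (E := fun x : N => TangentSpace (𝓡 (n + 1)) x →L[ℝ] TangentSpace (𝓡 (n + 1)) x →L[ℝ] ℝ)
        (e.symm y) (g.inner (e.symm y)))) e.target :=
    (g.contMDiff.of_le (by simp)).comp_contMDiffOn
      ((contMDiffOn_symm_of_mem_maximalAtlas he).of_le (by simp))
  have happly := ContMDiffOn.clm_bundle_apply₂ (F₁ := Model n) (F₂ := Model n) (F₃ := ℝ)
    (E₁ := fun x : N => TangentSpace (𝓡 (n + 1)) x)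
    (E₂ := fun x : N => TangentSpace (𝓡 (n + 1)) x)
    (E₃ := Bundle.Trivial N ℝ) hg (contMDiffOn_coordVec he i) (contMDiffOn_coordVec he j)
  exact fun y hy => (Bundle.contMDiffWithinAt_totalSpace.1 (happly y hy)).2.continuousWithinAt

theorem gram_posDef (he : e ∈ charts n N) {y : Model n} (hy : y ∈ e.target) :
    (gram g e y).PosDef := by
  refine Matrix.PosDef.of_dotProduct_mulVec_pos (Matrix.ext fun i j => ?_) fun c hc => ?_
  · simp [gram, g.symm]
  · set v : TangentSpace (𝓡 (n + 1)) (e.symm y) := ∑ i, c i • coordVec e y i with hv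
    have hv₀ : v ≠ 0 := fun h =>
      hc (funext (Fintype.linearIndependent_iff.1 (linearIndependent_coordVec he hy) c h))
    have hvv : star c ⬝ᵥ (gram g e y).mulVec c = g.inner (e.symm y) v v := by
      simp only [hv, map_sum, map_smul, sum_apply, smul_apply, smul_eq_mul, dotProduct,
        Matrix.mulVec, gram, Matrix.of_apply, Finset.mul_sum, star_trivial]
      rw [Finset.sum_comm]
      exact Finset.sum_congr rfl fun i _ => Finset.sum_congr rfl fun j _ => by ring
    rw [hvv]
    exact g.pos _ _ hv₀

theorem continuousOn_gram_det (he : e ∈ charts n N) :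
    ContinuousOn (fun y => (gram g e y).det) e.target :=
  continuous_id.matrix_det.comp_continuousOn <| continuousOn_pi.2 fun i =>
    continuousOn_pi.2 fun j => continuousOn_metric_coordVec g he i j

theorem aemeasurable_sqrt_gram_det (he : e ∈ charts n N) :
    AEMeasurable (fun y => ENNReal.ofReal √(gram g e y).det) (volume.restrict e.target) :=
  ((continuousOn_gram_det g he).aemeasurable e.open_target.measurableSet).sqrt.ennreal_ofReal

theorem aestronglyMeasurable_metric_coordVec (he : e ∈ charts n N)
    {X : (x : N) → TangentSpace (𝓡 (n + 1)) x}
    (hX : AEStronglyMeasurable (coords e X) (volume.restrict e.target)) (i : Fin (n + 1)) :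
    AEStronglyMeasurable (fun y => g.inner (e.symm y) (X (e.symm y)) (coordVec e y i))
      (volume.restrict e.target) := by
  simp only [fun y => g.symm (e.symm y) (X (e.symm y)) (coordVec e y i)]
  exact aestronglyMeasurable_clm_apply_chart he hX fun j =>
    (continuousOn_metric_coordVec g he i j).aestronglyMeasurable e.open_target.measurableSet

theorem aestronglyMeasurable_metric_self (he : e ∈ charts n N)
    {X : (x : N) → TangentSpace (𝓡 (n + 1)) x}
    (hX : AEStronglyMeasurable (coords e X) (volume.restrict e.target)) :
    AEStronglyMeasurable (fun y => g.inner (e.symm y) (X (e.symm y)) (X (e.symm y)))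
      (volume.restrict e.target) :=
  aestronglyMeasurable_clm_apply_chart he hX (aestronglyMeasurable_metric_coordVec g he hX)

end Charts

section RiemannianVolume

variable {n : ℕ} {N : Type*} [TopologicalSpace N] [ChartedSpace (Model n) N]
  [IsManifold (𝓡 (n + 1)) ∞ N] [MeasurableSpace N] {e : OpenPartialHomeomorph N (Model n)}
  (g : SmoothMetric n N)

theorem chartVolume_le_vol (he : e ∈ charts n N) : chartVolume g e ≤ vol g :=
  le_iSup₂ (f := fun e (_ : e ∈ charts n N) => chartVolume g e) e he

theorem vol_eq_zero_of_forall_chartVolume {A : Set N} (hA : MeasurableSet A)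
    (h : ∀ e ∈ charts n N, chartVolume g e A = 0) : vol g A = 0 :=
  iSup_measure_eq_zero hA fun e => iSup_measure_eq_zero hA (h e)

variable [BorelSpace N]

theorem aemeasurable_symm_withDensity (e : OpenPartialHomeomorph N (Model n)) :
    AEMeasurable e.symm
      ((volume.restrict e.target).withDensity fun y => ENNReal.ofReal √(gram g e y).det) :=
  (aemeasurable_chart_symm e volume).mono_ac (withDensity_absolutelyContinuous _ _)

theorem chartVolume_eq_zero (e : OpenPartialHomeomorph N (Model n)) {A : Set N}
    (hA : MeasurableSet A) (h₀ : volume (e.target ∩ e.symm ⁻¹' A) = 0) :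
    chartVolume g e A = 0 := by
  rw [chartVolume, Measure.map_apply_of_aemeasurable (aemeasurable_symm_withDensity g e) hA]
  refine withDensity_absolutelyContinuous _ _ ?_
  rwa [Measure.restrict_apply' e.open_target.measurableSet, inter_comm]

theorem vol_eq_zero_of_volume_eq_zero (he : e ∈ charts n N) {A : Set N} (hA : A ⊆ e.source)
    (h₀ : volume (e.target ∩ e.symm ⁻¹' A) = 0) : vol g A = 0 := by
  obtain ⟨f, hf, hfe⟩ := exists_measurable_eqOn_chart e
  set B := toMeasurable volume (e.target ∩ e.symm ⁻¹' A)
  have hB₀ : volume B = 0 := (measure_toMeasurable _).trans h₀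
  set C := e.source ∩ f ⁻¹' B
  have hC : MeasurableSet C :=
    e.open_source.measurableSet.inter (hf (measurableSet_toMeasurable _ _))
  have hAC : A ⊆ C := by
    refine fun x hx => ⟨hA hx, subset_toMeasurable _ _ ?_⟩
    rw [hfe (hA hx)]
    exact ⟨e.map_source (hA hx), by simpa [e.left_inv (hA hx)] using hx⟩
  refine measure_mono_null hAC (vol_eq_zero_of_forall_chartVolume g hC fun e' he' => ?_)
  have hsub : e'.target ∩ e'.symm ⁻¹' C ⊆
      (e' ∘ e.symm) '' (B ∩ (e.target ∩ e.symm ⁻¹' e'.source)) := by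
    rintro y ⟨hy, hye, hyB⟩
    rw [mem_preimage, hfe hye] at hyB
    refine ⟨e (e'.symm y), ⟨hyB, e.map_source hye, ?_⟩, ?_⟩
    · simpa [e.left_inv hye] using e'.map_target hy
    · simp [e.left_inv hye, e'.right_inv hy]
  -- differentiable maps between open subsets of `ℝ^(n+1)` preserve null sets
  exact chartVolume_eq_zero g e' hC <| measure_mono_null hsub <|
    addHaar_image_eq_zero_of_differentiableOn_of_addHaar_eq_zero _
      ((differentiableOn_transition he he').mono inter_subset_right)
      (measure_mono_null inter_subset_left hB₀)

theorem volume_eq_zero_of_vol_eq_zero (he : e ∈ charts n N) {A : Set N} (h₀ : vol g A = 0) :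
    volume (e.target ∩ e.symm ⁻¹' A) = 0 := by
  have hpre := Measure.preimage_null_of_map_null (aemeasurable_symm_withDensity g e)
    (Measure.absolutelyContinuous_of_le (chartVolume_le_vol g he) h₀)
  rw [withDensity_apply_eq_zero' (aemeasurable_sqrt_gram_det g he),
    Measure.restrict_apply' e.open_target.measurableSet] at hpre
  refine measure_mono_null ?_ hpre
  rintro y ⟨hy, hyA⟩
  exact ⟨⟨by simpa using (gram_posDef g he hy).det_pos, hyA⟩, hy⟩

theorem ae_restrict_source_iff (he : e ∈ charts n N) {p : N → Prop} :
    (∀ᵐ x ∂(vol g).restrict e.source, p x) ↔ ∀ᵐ y ∂volume.restrict e.target, p (e.symm y) := by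
  rw [ae_restrict_iff' e.open_source.measurableSet, ae_restrict_iff' e.open_target.measurableSet,
    ae_iff, ae_iff]
  simp only [Classical.not_imp]
  have hset : {y | y ∈ e.target ∧ ¬p (e.symm y)} =
      e.target ∩ e.symm ⁻¹' {x | x ∈ e.source ∧ ¬p x} := by
    ext y
    simp +contextual [e.map_target]
  rw [hset]
  exact ⟨volume_eq_zero_of_vol_eq_zero g he,
    vol_eq_zero_of_volume_eq_zero g he fun x hx => hx.1⟩

theorem ae_comp_chart_symm (he : e ∈ charts n N) {p : N → Prop} (h : ∀ᵐ x ∂vol g, p x) :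
    ∀ᵐ y ∂volume.restrict e.target, p (e.symm y) :=
  (ae_restrict_source_iff g he).1 (ae_restrict_of_ae h)

theorem map_chart_symm_absolutelyContinuous (he : e ∈ charts n N) :
    (volume.restrict e.target).map e.symm ≪ vol g := by
  refine Measure.AbsolutelyContinuous.mk fun s hs h₀ => ?_
  rw [Measure.map_apply_of_aemeasurable (aemeasurable_chart_symm e volume) hs,
    Measure.restrict_apply' e.open_target.measurableSet, inter_comm]
  exact volume_eq_zero_of_vol_eq_zero g he h₀

theorem aemeasurable_comp_chart_symm (he : e ∈ charts n N) {β : Type*} [MeasurableSpace β]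
    {f : N → β} (hf : AEMeasurable f (vol g)) :
    AEMeasurable (fun y => f (e.symm y)) (volume.restrict e.target) :=
  (hf.mono_ac (map_chart_symm_absolutelyContinuous g he)).comp_aemeasurable
    (aemeasurable_chart_symm e volume)

theorem aemeasurable_restrict_source (he : e ∈ charts n N) {f : N → ℝ}
    (hf : AEMeasurable (fun y => f (e.symm y)) (volume.restrict e.target)) :
    AEMeasurable f ((vol g).restrict e.source) := by
  obtain ⟨F, hF, hFe⟩ := exists_measurable_eqOn_chart e
  obtain ⟨G, hG, hfG⟩ := hf
  refine ⟨fun x => G (F x), hG.comp hF, (ae_restrict_source_iff g he).2 ?_⟩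
  filter_upwards [hfG, ae_restrict_mem e.open_target.measurableSet] with y hy hye
  rw [hy, hFe (e.map_target hye), e.right_inv hye]

theorem ae_of_forall_charts [LindelofSpace N] {p : N → Prop}
    (h : ∀ e ∈ charts n N, ∀ᵐ y ∂volume.restrict e.target, p (e.symm y)) :
    ∀ᵐ x ∂vol g, p x := by
  obtain ⟨s, hs, hcover⟩ := LindelofSpace.elim_nhds_subcover _
    fun x : N => chart_source_mem_nhds (Model n) x
  rw [← Measure.restrict_univ (μ := vol g), ← hcover, ae_restrict_biUnion_iff _ hs]
  exact fun z _ => (ae_restrict_source_iff g (IsManifold.chart_mem_maximalAtlas z)).2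
    (h _ (IsManifold.chart_mem_maximalAtlas z))

theorem aemeasurable_of_forall_charts [LindelofSpace N] {f : N → ℝ}
    (h : ∀ e ∈ charts n N, AEMeasurable (fun y => f (e.symm y)) (volume.restrict e.target)) :
    AEMeasurable f (vol g) := by
  obtain ⟨s, hs, hcover⟩ := LindelofSpace.elim_nhds_subcover _
    fun x : N => chart_source_mem_nhds (Model n) x
  have : Countable s := hs
  rw [← Measure.restrict_univ (μ := vol g), ← hcover, biUnion_eq_iUnion, aemeasurable_iUnion_iff]
  exact fun z => aemeasurable_restrict_source g (IsManifold.chart_mem_maximalAtlas z.1)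
    (h _ (IsManifold.chart_mem_maximalAtlas z.1))

theorem lintegral_chartVolume (he : e ∈ charts n N) {f : N → ℝ≥0∞} (hf : AEMeasurable f (vol g)) :
    ∫⁻ x, f x ∂chartVolume g e =
      ∫⁻ y in e.target, ENNReal.ofReal √(gram g e y).det * f (e.symm y) := by
  rw [chartVolume, lintegral_map' (hf.mono_measure (chartVolume_le_vol g he))
    (aemeasurable_symm_withDensity g e)]
  exact lintegral_withDensity_eq_lintegral_mul₀ (aemeasurable_sqrt_gram_det g he)
    (aemeasurable_comp_chart_symm g he hf)

theorem lintegral_isCompact_chart_lt_top (he : e ∈ charts n N) {f : N → ℝ≥0∞}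
    (hf : AEMeasurable f (vol g)) (hfin : ∫⁻ x, f x ∂vol g < ⊤) {K : Set (Model n)}
    (hK : IsCompact K) (hKe : K ⊆ e.target) : ∫⁻ y in K, f (e.symm y) < ⊤ := by
  rcases K.eq_empty_or_nonempty with rfl | hK₀
  · simp
  obtain ⟨y₀, hy₀, hmin⟩ := hK.exists_isMinOn hK₀ ((continuousOn_gram_det g he).mono hKe).sqrt
  set c := √(gram g e y₀).det
  have hc : 0 < c := Real.sqrt_pos.2 (gram_posDef g he (hKe hy₀)).det_pos
  have hle : ENNReal.ofReal c * ∫⁻ y in K, f (e.symm y) ≤ ∫⁻ x, f x ∂vol g :=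
    calc ENNReal.ofReal c * ∫⁻ y in K, f (e.symm y)
        = ∫⁻ y in K, ENNReal.ofReal c * f (e.symm y) :=
          (lintegral_const_mul' _ _ ENNReal.ofReal_ne_top).symm
      _ ≤ ∫⁻ y in K, ENNReal.ofReal √(gram g e y).det * f (e.symm y) := by
          refine setLIntegral_mono_ae' hK.measurableSet (ae_of_all _ fun y hy => ?_)
          gcongr
          exact hmin hy
      _ ≤ ∫⁻ y in e.target, ENNReal.ofReal √(gram g e y).det * f (e.symm y) :=
          lintegral_mono_set hKe
      _ = ∫⁻ x, f x ∂chartVolume g e := (lintegral_chartVolume g he hf).symm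
      _ ≤ ∫⁻ x, f x ∂vol g := lintegral_mono' (chartVolume_le_vol g he) le_rfl
  refine lt_top_iff_ne_top.2 fun htop => ?_
  rw [htop, ENNReal.mul_top (by simpa using hc)] at hle
  exact hfin.not_ge hle

theorem locallyIntegrableOn_of_abs_le_add (he : e ∈ charts n N) {f : N → ℝ}
    (hf : AEMeasurable f (vol g)) (hfin : ∫⁻ x, ENNReal.ofReal (f x) ∂vol g < ⊤)
    {k b : Model n → ℝ} (hk : AEStronglyMeasurable k (volume.restrict e.target))
    (hb : ContinuousOn b e.target) (hkb : ∀ y ∈ e.target, |k y| ≤ f (e.symm y) + b y) :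
    LocallyIntegrableOn k e.target := by
  refine (locallyIntegrableOn_iff e.open_target.isLocallyClosed).2 fun K hKe hK =>
    ⟨hk.mono_set hKe, ?_⟩
  have hf_fin := lintegral_isCompact_chart_lt_top g he hf.ennreal_ofReal hfin hK hKe
  have hb_fin : ∫⁻ y in K, ‖b y‖ₑ < ⊤ := ((hb.mono hKe).integrableOn_compact hK).2
  have hbm : AEMeasurable (fun y => ‖b y‖ₑ) (volume.restrict K) :=
    ((hb.mono hKe).aemeasurable hK.measurableSet).enorm
  refine lt_of_le_of_lt ?_ (ENNReal.add_lt_top.2 ⟨hf_fin, hb_fin⟩)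
  rw [← lintegral_add_right' _ hbm]
  refine setLIntegral_mono_ae' hK.measurableSet (ae_of_all _ fun y hy => ?_)
  simp only [Real.enorm_eq_ofReal_abs]
  exact (ENNReal.ofReal_le_ofReal ((hkb y (hKe hy)).trans (by gcongr; exact le_abs_self _))).trans
    ENNReal.ofReal_add_le

theorem locallyIntegrableOn_comp_chart_symm (he : e ∈ charts n N) {u : N → ℝ}
    (hu : MemLp u 2 (vol g)) : LocallyIntegrableOn (fun y => u (e.symm y)) e.target := by
  refine locallyIntegrableOn_of_abs_le_add g he (f := fun x => u x ^ 2) (b := fun _ => 1)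
    (hu.1.aemeasurable.pow_const 2) hu.integrable_sq.lintegral_lt_top
    (aemeasurable_comp_chart_symm g he hu.1.aemeasurable).aestronglyMeasurable
    continuousOn_const fun y _ => ?_
  nlinarith [sq_abs (u (e.symm y)), sq_nonneg (|u (e.symm y)| - 1), abs_nonneg (u (e.symm y))]

theorem aemeasurable_metric_self [LindelofSpace N] {X : (x : N) → TangentSpace (𝓡 (n + 1)) x}
    (hX : ∀ e ∈ charts n N, AEStronglyMeasurable (coords e X) (volume.restrict e.target)) :
    AEMeasurable (fun x => g.inner x (X x) (X x)) (vol g) :=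
  aemeasurable_of_forall_charts g fun e he =>
    (aestronglyMeasurable_metric_self g he (hX e he)).aemeasurable

theorem locallyIntegrableOn_metric_coordVec [LindelofSpace N] (he : e ∈ charts n N)
    {X : (x : N) → TangentSpace (𝓡 (n + 1)) x}
    (hX : ∀ e ∈ charts n N, AEStronglyMeasurable (coords e X) (volume.restrict e.target))
    (hfin : ∫⁻ x, ENNReal.ofReal (g.inner x (X x) (X x)) ∂vol g < ⊤) (i : Fin (n + 1)) :
    LocallyIntegrableOn (fun y => g.inner (e.symm y) (X (e.symm y)) (coordVec e y i)) e.target := by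
  refine locallyIntegrableOn_of_abs_le_add g he (aemeasurable_metric_self g hX) hfin
    (aestronglyMeasurable_metric_coordVec g he (hX e he) i) (continuousOn_metric_coordVec g he i i)
    fun y _ => ?_
  linarith [two_mul_abs_metric_le g (e.symm y) (X (e.symm y)) (coordVec e y i),
    abs_nonneg (g.inner (e.symm y) (X (e.symm y)) (coordVec e y i))]

end RiemannianVolume

section Gradient

variable {n : ℕ} {N : Type*} [TopologicalSpace N] [ChartedSpace (Model n) N]

theorem coords_zero (e : OpenPartialHomeomorph N (Model n)) : coords e 0 = 0 :=
  funext fun y => (mfderiv (𝓡 (n + 1)) (𝓡 (n + 1)) e (e.symm y)).map_zero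

theorem coords_add (e : OpenPartialHomeomorph N (Model n))
    (X Y : (x : N) → TangentSpace (𝓡 (n + 1)) x) :
    coords e (X + Y) = coords e X + coords e Y :=
  funext fun y => (mfderiv (𝓡 (n + 1)) (𝓡 (n + 1)) e (e.symm y)).map_add _ _

theorem coords_smul (e : OpenPartialHomeomorph N (Model n)) (f : N → ℝ)
    (X : (x : N) → TangentSpace (𝓡 (n + 1)) x) :
    coords e (fun x => f x • X x) = fun y => f (e.symm y) • coords e X y :=
  funext fun y => (mfderiv (𝓡 (n + 1)) (𝓡 (n + 1)) e (e.symm y)).map_smul _ _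

variable [IsManifold (𝓡 (n + 1)) ∞ N] {g : SmoothMetric n N}
  {e : OpenPartialHomeomorph N (Model n)} {u v : N → ℝ}
  {X Y : (x : N) → TangentSpace (𝓡 (n + 1)) x}

theorem IsWeakGradient.hasWeakDeriv (h : IsWeakGradient g u X) (he : e ∈ charts n N)
    (i : Fin (n + 1)) :
    HasWeakDeriv volume e.target (fun y => u (e.symm y))
      (fun y => g.inner (e.symm y) (X (e.symm y)) (coordVec e y i))
      (EuclideanSpace.single i (1 : ℝ)) :=
  fun η hη hηc hηe => h.integral_eq e he η hη hηc hηe i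

theorem isWeakGradient_of_hasWeakDeriv
    (hX : ∀ e ∈ charts n N, AEStronglyMeasurable (coords e X) (volume.restrict e.target))
    (h : ∀ e ∈ charts n N, ∀ i, HasWeakDeriv volume e.target (fun y => u (e.symm y))
      (fun y => g.inner (e.symm y) (X (e.symm y)) (coordVec e y i))
      (EuclideanSpace.single i (1 : ℝ))) :
    IsWeakGradient g u X :=
  ⟨hX, fun e he η hη hηc hηe i => h e he i η hη hηc hηe⟩

variable [MeasurableSpace N]

/-- `u` is square integrable with the square integrable distributional gradient `X`. -/
structure IsL2Gradient (g : SmoothMetric n N) (u : N → ℝ)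
    (X : (x : N) → TangentSpace (𝓡 (n + 1)) x) : Prop where
  memLp : MemLp u 2 (vol g)
  weak : IsWeakGradient g u X
  finite : ∫⁻ x, ENNReal.ofReal (g.inner x (X x) (X x)) ∂vol g < ⊤

theorem IsL2Gradient.zero : IsL2Gradient g 0 0 where
  memLp := .zero
  weak :=
    { measurable_coords := fun e _ => coords_zero e ▸ aestronglyMeasurable_zero
      integral_eq := by simp }
  finite := by simp

theorem integrable_metric_self (hX : AEMeasurable (fun x => g.inner x (X x) (X x)) (vol g)) :
    ∫⁻ x, ENNReal.ofReal (g.inner x (X x) (X x)) ∂vol g < ⊤ ↔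
      Integrable (fun x => g.inner x (X x) (X x)) (vol g) := by
  rw [Integrable, hasFiniteIntegral_iff_ofReal (ae_of_all _ fun x => metric_self_nonneg g x _),
    and_iff_right hX.aestronglyMeasurable]

theorem IsL2Gradient.const_smul (h : IsL2Gradient g u X) (c : ℝ) :
    IsL2Gradient g (c • u) (c • X) where
  memLp := h.memLp.const_smul c
  weak := isWeakGradient_of_hasWeakDeriv
    (fun e he => (coords_smul e (fun _ => c) X).symm ▸
      (h.weak.measurable_coords e he).const_smul c)
    fun e he i => by simpa using (h.weak.hasWeakDeriv he i).const_mul c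
  finite := by
    have hsq (x : N) : g.inner x ((c • X) x) ((c • X) x) = c ^ 2 * g.inner x (X x) (X x) := by
      simp only [Pi.smul_apply, map_smul, smul_apply, smul_eq_mul]
      ring
    simp only [hsq, ENNReal.ofReal_mul (sq_nonneg c)]
    rw [lintegral_const_mul' _ _ ENNReal.ofReal_ne_top]
    exact ENNReal.mul_lt_top ENNReal.ofReal_lt_top h.finite

variable [BorelSpace N]

theorem IsWeakGradient.congr (h : IsWeakGradient g u X) (huv : u =ᵐ[vol g] v) :
    IsWeakGradient g v X := by
  refine ⟨h.measurable_coords, fun e he η hη hηc hηe i => ?_⟩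
  rw [← h.integral_eq e he η hη hηc hηe i]
  have huv' := (ae_restrict_iff' e.open_target.measurableSet).1 (ae_comp_chart_symm g he huv)
  refine integral_congr_ae ?_
  filter_upwards [huv'] with y hy
  by_cases hye : y ∈ e.target
  · rw [hy hye]
  · rw [fderiv_of_notMem_tsupport ℝ fun hyη => hye (hηe hyη)]
    simp

theorem IsL2Gradient.congr (h : IsL2Gradient g u X) (huv : u =ᵐ[vol g] v) : IsL2Gradient g v X :=
  ⟨h.memLp.ae_eq huv, h.weak.congr huv, h.finite⟩

variable [LindelofSpace N]

theorem IsL2Gradient.locallyIntegrableOn (h : IsL2Gradient g u X) (he : e ∈ charts n N)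
    (i : Fin (n + 1)) :
    LocallyIntegrableOn (fun y => g.inner (e.symm y) (X (e.symm y)) (coordVec e y i)) e.target :=
  locallyIntegrableOn_metric_coordVec g he h.weak.measurable_coords h.finite i

theorem IsL2Gradient.ae_unique (hX : IsL2Gradient g u X) (hY : IsL2Gradient g u Y) :
    ∀ᵐ x ∂vol g, X x = Y x := by
  refine ae_of_forall_charts g fun e he => (ae_restrict_iff' e.open_target.measurableSet).2 ?_
  have hcoord (i : Fin (n + 1)) := (hX.weak.hasWeakDeriv he i).ae_unique e.open_target
    (hX.locallyIntegrableOn he i) (hY.locallyIntegrableOn he i) (hY.weak.hasWeakDeriv he i)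
  filter_upwards [ae_all_iff.2 hcoord] with y hy hye
  set Z : (x : N) → TangentSpace (𝓡 (n + 1)) x := fun x => X x - Y x
  have horth : g.inner (e.symm y) (Z (e.symm y)) (Z (e.symm y)) = 0 := by
    conv_lhs => enter [2]; rw [← sum_coords_smul_coordVec he Z hye]
    simp only [map_sum, map_smul]
    refine Finset.sum_eq_zero fun i _ => ?_
    simp only [Z, map_sub, sub_apply, hy i hye, sub_self, smul_zero]
  by_contra hne
  exact (g.pos (e.symm y) _ (sub_ne_zero.2 hne)).ne' horth

theorem IsL2Gradient.add (hX : IsL2Gradient g u X) (hY : IsL2Gradient g v Y) :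
    IsL2Gradient g (u + v) (X + Y) where
  memLp := hX.memLp.add hY.memLp
  weak := isWeakGradient_of_hasWeakDeriv
    (fun e he => by
      simpa only [coords_add] using
        (hX.weak.measurable_coords e he).add (hY.weak.measurable_coords e he))
    fun e he i => by
      simpa using HasWeakDeriv.add (locallyIntegrableOn_comp_chart_symm g he hX.memLp)
        (locallyIntegrableOn_comp_chart_symm g he hY.memLp) (hX.locallyIntegrableOn he i)
        (hY.locallyIntegrableOn he i) (hX.weak.hasWeakDeriv he i) (hY.weak.hasWeakDeriv he i)
  finite := by
    have hXX := aemeasurable_metric_self g hX.weak.measurable_coords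
    have hYY := aemeasurable_metric_self g hY.weak.measurable_coords
    have hsum := (((integrable_metric_self hXX).1 hX.finite).const_mul 2).add
      (((integrable_metric_self hYY).1 hY.finite).const_mul 2)
    exact (lintegral_mono fun x => ENNReal.ofReal_le_ofReal
      (metric_add_self_le g x (X x) (Y x))).trans_lt hsum.lintegral_lt_top

theorem IsL2Gradient.abs (h : IsL2Gradient g u X) :
    IsL2Gradient g (fun x => |u x|) (fun x => (SignType.sign (u x) : ℝ) • X x) where
  memLp := h.memLp.abs
  weak := isWeakGradient_of_hasWeakDeriv
    (fun e he => by
      rw [coords_smul]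
      exact (measurable_coe_sign.comp_aemeasurable (aemeasurable_comp_chart_symm g he
        h.memLp.1.aemeasurable)).aestronglyMeasurable.smul (h.weak.measurable_coords e he))
    fun e he i => by
      simpa using (h.weak.hasWeakDeriv he i).abs e.open_target
        (locallyIntegrableOn_comp_chart_symm g he h.memLp) (h.locallyIntegrableOn he i)
  finite := by
    refine (lintegral_mono fun x => ENNReal.ofReal_le_ofReal ?_).trans_lt h.finite
    have hnonneg := metric_self_nonneg g x (X x)
    rcases lt_trichotomy (u x) 0 with hu | hu | hu <;> simp [hu, hnonneg]

theorem IsL2Gradient.integrable_metric (hX : IsL2Gradient g u X) (hY : IsL2Gradient g v Y) :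
    Integrable (fun x => g.inner x (X x) (Y x)) (vol g) := by
  have hself {w : N → ℝ} {Z : (x : N) → TangentSpace (𝓡 (n + 1)) x} (h : IsL2Gradient g w Z) :=
    (integrable_metric_self (aemeasurable_metric_self g h.weak.measurable_coords)).1 h.finite
  refine ((((hself (hX.add hY)).sub (hself hX)).sub (hself hY)).const_mul 2⁻¹).congr
    (ae_of_all _ fun x => ?_)
  simp only [Pi.sub_apply, Pi.add_apply, map_add, add_apply, g.symm x (Y x) (X x)]
  ring

theorem IsL2Gradient.ae_eq_zero_of_eq_zero (h : IsL2Gradient g u X) :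
    ∀ᵐ x ∂vol g, u x = 0 → X x = 0 := by
  -- `p = (u + |u|) / 2` satisfies `|p| = p`, so `∇p = sign p • ∇p`,
  -- while `∇p = ∇u / 2` on `{u = 0}`.
  have hp := (h.add h.abs).const_smul 2⁻¹
  have hpabs : (fun x => |((2⁻¹ : ℝ) • (u + fun x => |u x|)) x|) =
      (2⁻¹ : ℝ) • (u + fun x => |u x|) := by
    ext x
    refine abs_of_nonneg ?_
    have := neg_abs_le (u x)
    simp only [Pi.smul_apply, Pi.add_apply, smul_eq_mul]
    linarith
  filter_upwards [hp.abs.ae_unique (hpabs ▸ hp)] with x hx hux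
  simpa [hux, eq_comm] using hx

end Gradient

namespace H1

section Structure

variable {n : ℕ} {N : Type*} [TopologicalSpace N] [ChartedSpace (Model n) N]
  [IsManifold (𝓡 (n + 1)) ∞ N] [MeasurableSpace N] {g : SmoothMetric n N}

theorem isL2Gradient (u : H1 g) : IsL2Gradient g u u.grad :=
  ⟨Lp.memLp u.1, u.2.choose_spec.1, u.2.choose_spec.2⟩

variable [BorelSpace N] [LindelofSpace N]

/-- `H¹(N)` as a vector subspace of `L²(N)`: it carries the vector space structure of `H1 g`. -/
def submodule (g : SmoothMetric n N) : Submodule ℝ (Lp ℝ 2 (vol g)) where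
  carrier := {u | ∃ X : (x : N) → TangentSpace (𝓡 (n + 1)) x,
    IsWeakGradient g u X ∧ ∫⁻ x, ENNReal.ofReal (g.inner x (X x) (X x)) ∂vol g < ⊤}
  zero_mem' :=
    have h := (IsL2Gradient.zero (g := g)).congr (Lp.coeFn_zero ℝ 2 (vol g)).symm
    ⟨0, h.weak, h.finite⟩
  add_mem' := by
    rintro u v ⟨X, hX, hX'⟩ ⟨Y, hY, hY'⟩
    have h := (IsL2Gradient.mk (Lp.memLp u) hX hX').add ⟨Lp.memLp v, hY, hY'⟩
    exact ⟨X + Y, (h.congr (Lp.coeFn_add u v).symm).weak, h.finite⟩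
  smul_mem' := by
    rintro c u ⟨X, hX, hX'⟩
    have h := (IsL2Gradient.mk (Lp.memLp u) hX hX').const_smul c
    exact ⟨c • X, (h.congr (Lp.coeFn_smul c u).symm).weak, h.finite⟩

instance : AddCommGroup (H1 g) := inferInstanceAs (AddCommGroup (submodule g))

instance : Module ℝ (H1 g) := inferInstanceAs (Module ℝ (submodule g))

theorem abs_mem_submodule {u : Lp ℝ 2 (vol g)} (hu : u ∈ submodule g) : |u| ∈ submodule g := by
  obtain ⟨X, hX, hX'⟩ := hu
  have h := (IsL2Gradient.mk (Lp.memLp u) hX hX').abs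
  exact ⟨_, (h.congr (Lp.coeFn_abs u).symm).weak, h.finite⟩

theorem sup_mem_submodule {u v : Lp ℝ 2 (vol g)} (hu : u ∈ submodule g) (hv : v ∈ submodule g) :
    u ⊔ v ∈ submodule g := by
  rw [sup_eq_half_smul_add_add_abs_sub' ℝ]
  exact Submodule.smul_mem _ _ <|
    add_mem (add_mem hu hv) (abs_mem_submodule (sub_mem hv hu))

theorem inf_mem_submodule {u v : Lp ℝ 2 (vol g)} (hu : u ∈ submodule g) (hv : v ∈ submodule g) :
    u ⊓ v ∈ submodule g := by
  rw [inf_eq_half_smul_add_sub_abs_sub' ℝ]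
  exact Submodule.smul_mem _ _ <|
    sub_mem (add_mem hu hv) (abs_mem_submodule (sub_mem hv hu))

instance : Lattice (H1 g) :=
  Subtype.lattice (fun _ _ => sup_mem_submodule (g := g)) fun _ _ => inf_mem_submodule (g := g)

instance : IsOrderedAddMonoid (H1 g) := inferInstanceAs (IsOrderedAddMonoid (submodule g))

theorem coe_add (u v : H1 g) : ∀ᵐ x ∂vol g, (u + v) x = u x + v x := Lp.coeFn_add u.1 v.1

theorem coe_smul (c : ℝ) (u : H1 g) : ∀ᵐ x ∂vol g, (c • u) x = c * u x := Lp.coeFn_smul c u.1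

theorem coe_sub (u v : H1 g) : ∀ᵐ x ∂vol g, (u - v) x = u x - v x := Lp.coeFn_sub u.1 v.1

theorem coe_sup (u v : H1 g) : ∀ᵐ x ∂vol g, (u ⊔ v) x = u x ⊔ v x := Lp.coeFn_sup u.1 v.1

theorem coe_inf (u v : H1 g) : ∀ᵐ x ∂vol g, (u ⊓ v) x = u x ⊓ v x := Lp.coeFn_inf u.1 v.1

theorem coe_abs (u : H1 g) : ∀ᵐ x ∂vol g, |u| x = |u x| := Lp.coeFn_abs u.1

theorem le_iff {u v : H1 g} : u ≤ v ↔ ∀ᵐ x ∂vol g, u x ≤ v x := (Lp.coeFn_le u.1 v.1).symm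

instance : SMulPosMono ℝ (H1 g) where
  smul_le_smul_of_nonneg_right u hu c d hcd := by
    rw [le_iff]
    filter_upwards [le_iff.1 hu, Lp.coeFn_zero ℝ 2 (vol g), coe_smul c u, coe_smul d u]
      with x hux hzero hc hd
    rw [hc, hd]
    exact mul_le_mul_of_nonneg_right hcd (hzero.symm.trans_le hux)

theorem grad_ae_eq {u : H1 g} {X : (x : N) → TangentSpace (𝓡 (n + 1)) x}
    (h : IsL2Gradient g u X) : ∀ᵐ x ∂vol g, u.grad x = X x :=
  u.isL2Gradient.ae_unique h

theorem grad_add (u v : H1 g) : ∀ᵐ x ∂vol g, (u + v).grad x = u.grad x + v.grad x :=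
  grad_ae_eq <| (u.isL2Gradient.add v.isL2Gradient).congr (EventuallyEq.symm (coe_add u v))

theorem grad_smul (c : ℝ) (u : H1 g) : ∀ᵐ x ∂vol g, (c • u).grad x = c • u.grad x :=
  grad_ae_eq <| (u.isL2Gradient.const_smul c).congr (EventuallyEq.symm (coe_smul c u))

theorem grad_sub (u v : H1 g) : ∀ᵐ x ∂vol g, (u - v).grad x = u.grad x - v.grad x := by
  filter_upwards [grad_add (u - v) v] with x hx
  rw [sub_add_cancel] at hx
  rw [hx, add_sub_cancel_right]

theorem grad_abs (u : H1 g) :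
    ∀ᵐ x ∂vol g, |u|.grad x = (SignType.sign (u x) : ℝ) • u.grad x :=
  grad_ae_eq <| u.isL2Gradient.abs.congr (EventuallyEq.symm (coe_abs u))

theorem grad_eq_zero_of_eq_zero (u : H1 g) : ∀ᵐ x ∂vol g, u x = 0 → u.grad x = 0 :=
  u.isL2Gradient.ae_eq_zero_of_eq_zero

theorem grad_sup (u v : H1 g) :
    ∀ᵐ x ∂vol g, (u ⊔ v).grad x = if v x ≤ u x then u.grad x else v.grad x := by
  have hsup := sup_eq_half_smul_add_add_abs_sub' ℝ u v
  filter_upwards [hsup ▸ grad_smul 2⁻¹ (u + v + |v - u|), grad_add (u + v) |v - u|, grad_add u v,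
    grad_abs (v - u), grad_sub v u, coe_sub v u, grad_eq_zero_of_eq_zero (v - u)]
    with x hsmul hadd hadd' habs hsub hval hzero
  rw [hsmul, hadd, hadd', habs, hsub, hval]
  rw [hsub, hval] at hzero
  rcases lt_trichotomy (v x - u x) 0 with h | h | h
  · rw [if_pos (by linarith), sign_neg h, SignType.coe_neg_one]
    module
  · rw [if_pos (by linarith), h, sign_zero, sub_eq_zero.1 (hzero h), SignType.coe_zero]
    module
  · rw [if_neg (by linarith), sign_pos h, SignType.coe_one]
    module

theorem grad_inf (u v : H1 g) :
    ∀ᵐ x ∂vol g, (u ⊓ v).grad x = if v x ≤ u x then v.grad x else u.grad x := by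
  filter_upwards [grad_sup u v, grad_add (u ⊓ v) (u ⊔ v), grad_add u v] with x hsup hadd hadd'
  rw [inf_add_sup, hadd', hsup] at hadd
  split_ifs at hadd ⊢
  · exact add_right_cancel (hadd.symm.trans (add_comm _ _))
  · exact (add_right_cancel hadd).symm

theorem integrable_inner (u v : H1 g) :
    Integrable (fun x => u x * v x + g.inner x (u.grad x) (v.grad x)) (vol g) :=
  (u.isL2Gradient.memLp.integrable_mul v.isL2Gradient.memLp).add
    (u.isL2Gradient.integrable_metric v.isL2Gradient)

/-- The inner product `∫ u v + g(∇u, ∇v)` of `H¹(N)`. -/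
instance : PreInnerProductSpace.Core ℝ (H1 g) where
  inner u v := ∫ x, (u x * v x + g.inner x (u.grad x) (v.grad x)) ∂vol g
  conj_inner_symm u v := by
    simp only [mul_comm, g.symm, conj_trivial]
  re_inner_nonneg u := by
    exact integral_nonneg fun x => add_nonneg (mul_self_nonneg _) (metric_self_nonneg g x _)
  add_left u v w := by
    rw [← integral_add (integrable_inner u w) (integrable_inner v w)]
    refine integral_congr_ae ?_
    filter_upwards [coe_add u v, grad_add u v] with x hx hx'
    simp only [hx, hx', map_add, add_apply]
    ring
  smul_left u v c := by
    rw [conj_trivial, ← integral_const_mul]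
    refine integral_congr_ae ?_
    filter_upwards [coe_smul c u, grad_smul c u] with x hx hx'
    simp only [hx, hx', map_smul, smul_apply, smul_eq_mul]
    ring

instance : SeminormedAddCommGroup (H1 g) := InnerProductSpace.Core.toSeminormedAddCommGroup (𝕜 := ℝ)

instance : InnerProductSpace ℝ (H1 g) := InnerProductSpace.ofCore inferInstance

theorem norm_sq_eq_integral (u : H1 g) :
    ‖u‖ ^ 2 = ∫ x, (u x ^ 2 + g.inner x (u.grad x) (u.grad x)) ∂vol g := by
  simp only [sq (u _)]
  exact InnerProductSpace.norm_sq_eq_re_inner (𝕜 := ℝ) u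

theorem integrable_sq_add_metric (u : H1 g) :
    Integrable (fun x => u x ^ 2 + g.inner x (u.grad x) (u.grad x)) (vol g) := by
  simpa only [sq] using integrable_inner u u

theorem ofReal_norm_sq (u : H1 g) : ENNReal.ofReal (‖u‖ ^ 2) =
    ∫⁻ x, ENNReal.ofReal (u x ^ 2 + g.inner x (u.grad x) (u.grad x)) ∂vol g := by
  rw [norm_sq_eq_integral, ofReal_integral_eq_lintegral_ofReal (integrable_sq_add_metric u)]
  exact ae_of_all _ fun x => add_nonneg (sq_nonneg _) (metric_self_nonneg g x _)

theorem normDist_eq (u v : H1 g) : u.normDist v = ENNReal.ofReal (dist u v) := by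
  have hdist : ENNReal.ofReal (dist u v) ^ (2 : ℝ) = u.normDist v ^ (2 : ℝ) := by
    rw [normDist, ← ENNReal.rpow_mul, one_div_mul_cancel two_ne_zero, ENNReal.rpow_one,
      ENNReal.rpow_two, ← ENNReal.ofReal_pow dist_nonneg, dist_eq_norm, ofReal_norm_sq]
    refine lintegral_congr_ae ?_
    filter_upwards [coe_sub u v, grad_sub u v] with x hx hx'
    rw [hx, hx']
  exact (ENNReal.rpow_left_injective two_ne_zero hdist).symm

theorem continuousPath_iff {φ : unitInterval → H1 g} : ContinuousPath φ ↔ Continuous φ := by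
  simp only [ContinuousPath, normDist_eq, continuous_iff_continuousAt, ContinuousAt,
    ← edist_dist, ← tendsto_iff_edist_tendsto_0]

theorem isNested_iff {φ : unitInterval → H1 g} : IsNested φ ↔ Continuous φ ∧ Antitone φ :=
  ⟨fun h => ⟨continuousPath_iff.1 h.1, fun t s hts => le_iff.2 (h.2 t s hts)⟩,
    fun h => ⟨continuousPath_iff.2 h.1, fun _ _ hts => le_iff.1 (h.2 hts)⟩⟩

end Structure

end H1

theorem abs_coe_sign_le_one (t : ℝ) : |(SignType.sign t : ℝ)| ≤ 1 := by
  rcases lt_trichotomy t 0 with h | h | h <;> simp [h]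

theorem sign_sub_sign_sq_le (s t : ℝ) :
    ((SignType.sign s : ℝ) - SignType.sign t) ^ 2 ≤ 4 := by
  have hs := abs_le.1 (abs_coe_sign_le_one s)
  have ht := abs_le.1 (abs_coe_sign_le_one t)
  nlinarith

theorem norm_sign_sub_mul_le (s t q : ℝ) :
    ‖((SignType.sign s : ℝ) - SignType.sign t) ^ 2 * q‖ ≤ 4 * ‖q‖ := by
  rw [norm_mul, norm_pow, Real.norm_eq_abs, sq_abs]
  gcongr
  exact sign_sub_sign_sq_le s t

section Continuity

variable {n : ℕ} {N : Type*} [TopologicalSpace N] [ChartedSpace (Model n) N]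
  [IsManifold (𝓡 (n + 1)) ∞ N] {g : SmoothMetric n N}

theorem metric_sign_smul_sub_le (s t : ℝ) (x : N) (v w : TangentSpace (𝓡 (n + 1)) x) :
    g.inner x ((SignType.sign t : ℝ) • w - (SignType.sign s : ℝ) • v)
        ((SignType.sign t : ℝ) • w - (SignType.sign s : ℝ) • v) ≤
      2 * g.inner x (w - v) (w - v) +
        2 * (((SignType.sign t : ℝ) - SignType.sign s) ^ 2 * g.inner x v v) := by
  set σ : ℝ := ((SignType.sign t : SignType) : ℝ)
  set τ : ℝ := ((SignType.sign s : SignType) : ℝ)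
  have hsplit : σ • w - τ • v = σ • (w - v) + (σ - τ) • v := by module
  have hσ : σ ^ 2 ≤ 1 := (sq_le_one_iff_abs_le_one σ).2 (abs_coe_sign_le_one t)
  have hwv := mul_le_mul_of_nonneg_right hσ (metric_self_nonneg g x (w - v))
  rw [hsplit]
  refine (metric_add_self_le g x _ _).trans ?_
  simp only [map_smul, smul_apply, smul_eq_mul]
  linarith

namespace H1

variable [MeasurableSpace N]

theorem aestronglyMeasurable_sign (u : H1 g) :
    AEStronglyMeasurable (fun x => (SignType.sign (u x) : ℝ)) (vol g) :=
  (measurable_coe_sign.comp_aemeasurable u.isL2Gradient.memLp.1.aemeasurable).aestronglyMeasurable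

variable [BorelSpace N] [LindelofSpace N]

theorem norm_val_le (u : H1 g) : ‖u.1‖ ≤ ‖u‖ := by
  refine pow_le_pow_iff_left₀ (norm_nonneg _) (norm_nonneg _) two_ne_zero |>.1 ?_
  rw [norm_sq_eq_integral, ← real_inner_self_eq_norm_sq, L2.inner_def]
  refine integral_mono (L2.integrable_inner _ _) (integrable_sq_add_metric u) fun x => ?_
  simpa [sq] using metric_self_nonneg g x (u.grad x)

theorem continuous_val : Continuous fun u : H1 g => u.1 :=
  (LipschitzWith.of_dist_le_mul (K := 1) fun u v => by
    simpa only [dist_eq_norm, NNReal.coe_one, one_mul] using! norm_val_le (u - v)).continuous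

theorem exists_subseq_tendsto_ae {U : ℕ → H1 g} {u : H1 g} (hU : Tendsto U atTop (𝓝 u)) :
    ∃ ns : ℕ → ℕ, StrictMono ns ∧
      ∀ᵐ x ∂vol g, Tendsto (fun k => U (ns k) x) atTop (𝓝 (u x)) :=
  (tendstoInMeasure_of_tendsto_Lp ((continuous_val.tendsto u).comp hU)).exists_seq_tendsto_ae

theorem integrable_sign_sub_mul (u v : H1 g) :
    Integrable (fun x => ((SignType.sign (v x) : ℝ) - SignType.sign (u x)) ^ 2 *
      g.inner x (u.grad x) (u.grad x)) (vol g) := by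
  have hint := u.isL2Gradient.integrable_metric u.isL2Gradient
  refine (hint.norm.const_mul 4).mono' ?_ (ae_of_all _ fun x => norm_sign_sub_mul_le _ _ _)
  exact (((aestronglyMeasurable_sign v).sub (aestronglyMeasurable_sign u)).pow 2).mul hint.1

theorem norm_abs_sub_abs_sq_le (u v : H1 g) :
    ‖|v| - |u|‖ ^ 2 ≤ 2 * ‖v - u‖ ^ 2 +
      2 * ∫ x, ((SignType.sign (v x) : ℝ) - SignType.sign (u x)) ^ 2 *
        g.inner x (u.grad x) (u.grad x) ∂vol g := by
  simp only [norm_sq_eq_integral, ← integral_const_mul]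
  rw [← integral_add ((integrable_sq_add_metric _).const_mul 2)
    ((integrable_sign_sub_mul u v).const_mul 2)]
  refine integral_mono_ae (integrable_sq_add_metric _) (((integrable_sq_add_metric _).const_mul
    2).add ((integrable_sign_sub_mul u v).const_mul 2)) ?_
  filter_upwards [coe_sub |v| |u|, coe_sub v u, coe_abs v, coe_abs u, grad_sub |v| |u|,
    grad_sub v u, grad_abs v, grad_abs u] with x h₁ h₂ h₃ h₄ h₅ h₆ h₇ h₈
  rw [h₁, h₂, h₃, h₄, h₅, h₆, h₇, h₈]
  have habs : (|v x| - |u x|) ^ 2 ≤ (v x - u x) ^ 2 := sq_le_sq.2 (abs_abs_sub_abs_le _ _)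
  have hgrad := metric_sign_smul_sub_le (g := g) (u x) (v x) x (u.grad x) (v.grad x)
  linarith [sq_nonneg (v x - u x)]

theorem tendsto_integral_sign_sub {U : ℕ → H1 g} {u : H1 g}
    (hU : ∀ᵐ x ∂vol g, Tendsto (fun k => U k x) atTop (𝓝 (u x))) :
    Tendsto (fun k => ∫ x, ((SignType.sign (U k x) : ℝ) - SignType.sign (u x)) ^ 2 *
      g.inner x (u.grad x) (u.grad x) ∂vol g) atTop (𝓝 0) := by
  rw [← integral_zero N ℝ]
  refine tendsto_integral_of_dominated_convergence _
    (fun k => (integrable_sign_sub_mul u (U k)).1)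
    ((u.isL2Gradient.integrable_metric u.isL2Gradient).norm.const_mul 4)
    (fun k => ae_of_all _ fun x => norm_sign_sub_mul_le _ _ _) ?_
  filter_upwards [hU, grad_eq_zero_of_eq_zero u] with x hx hgrad
  rcases eq_or_ne (u x) 0 with h₀ | h₀
  · simp [hgrad h₀]
  · have hsign : (fun k => SignType.sign (U k x)) =ᶠ[atTop] fun _ => SignType.sign (u x) :=
      ((continuousAt_sign_of_ne_zero h₀).tendsto.comp hx).eventually_mem
        (mem_nhds_discrete (s := {_}).2 rfl)
    refine tendsto_const_nhds.congr' (hsign.mono fun k hk => ?_)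
    simp [hk]

theorem continuous_abs : Continuous fun u : H1 g => |u| := by
  refine continuous_iff_seqContinuous.2 fun U u hU => tendsto_of_subseq_tendsto fun ns hns => ?_
  have hUns := hU.comp hns
  obtain ⟨ms, hms, hae⟩ := exists_subseq_tendsto_ae hUns
  refine ⟨ms, tendsto_iff_norm_sub_tendsto_zero.2 ?_⟩
  have hnorm := (tendsto_iff_norm_sub_tendsto_zero.1 (hUns.comp hms.tendsto_atTop)).pow 2
  have hbound := (hnorm.const_mul 2).add ((tendsto_integral_sign_sub hae).const_mul 2)
  simp only [zero_pow two_ne_zero, mul_zero, add_zero] at hbound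
  have hsq := squeeze_zero (fun k => sq_nonneg _)
    (fun k => norm_abs_sub_abs_sq_le u (U (ns (ms k)))) hbound
  simpa using hsq.sqrt

instance : ContinuousSup (H1 g) where
  continuous_sup := by
    simp only [sup_eq_half_smul_add_add_abs_sub' ℝ]
    exact (continuous_fst.add continuous_snd).add
      ((continuous_abs (g := g)).comp (continuous_snd.sub continuous_fst)) |>.const_smul (2⁻¹ : ℝ)

instance : ContinuousInf (H1 g) where
  continuous_inf := by
    simp only [inf_eq_half_smul_add_sub_abs_sub' ℝ]
    exact (continuous_fst.add continuous_snd).sub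
      ((continuous_abs (g := g)).comp (continuous_snd.sub continuous_fst)) |>.const_smul (2⁻¹ : ℝ)

end H1

end Continuity

section Potential

variable {f : ℝ → ℝ} {s : Set ℝ} {K : NNReal} {x y : ℝ}

theorem le_add_deriv_mul_add_sq (hf : Differentiable ℝ f) (hs : s.OrdConnected)
    (hK : LipschitzOnWith K (deriv f) s) (hx : x ∈ s) (hy : y ∈ s) :
    f y ≤ f x + deriv f x * (y - x) + K * (y - x) ^ 2 := by
  have hderiv (z : ℝ) : HasDerivAt (fun z => f z - deriv f x * z) (deriv f z - deriv f x) z := by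
    simpa using! (hf z).hasDerivAt.sub ((hasDerivAt_id z).const_mul (deriv f x))
  have hbound (z : ℝ) (hz : z ∈ uIcc x y) : ‖deriv f z - deriv f x‖ ≤ K * |y - x| :=
    (hK.norm_sub_le (hs.uIcc_subset hx hy hz) hx).trans
      (mul_le_mul_of_nonneg_left (abs_sub_left_of_mem_uIcc hz) K.2)
  have hmvt := (convex_uIcc x y).norm_image_sub_le_of_norm_hasDerivWithin_le
    (fun z _ => (hderiv z).hasDerivWithinAt) hbound left_mem_uIcc right_mem_uIcc
  rw [Real.norm_eq_abs, Real.norm_eq_abs, mul_assoc, abs_mul_abs_self] at hmvt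
  linarith [(abs_le.1 hmvt).2]

/-- Glaeser's inequality: `f` is still nonnegative after the step `-f'(x) / (2K)`. -/
theorem deriv_sq_le_of_nonneg (hf : Differentiable ℝ f) (hs : s.OrdConnected)
    (hK : LipschitzOnWith K (deriv f) s) (hK₀ : 0 < K) (hx : x ∈ s)
    (hy : x - deriv f x / (2 * K) ∈ s) (hnonneg : 0 ≤ f (x - deriv f x / (2 * K))) :
    deriv f x ^ 2 ≤ 4 * K * f x := by
  have : (0 : ℝ) < K := hK₀
  have htaylor := hnonneg.trans (le_add_deriv_mul_add_sq hf hs hK hx hy)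
  have heq : f x + deriv f x * (x - deriv f x / (2 * K) - x) +
      K * (x - deriv f x / (2 * K) - x) ^ 2 = (4 * K * f x - deriv f x ^ 2) / (4 * K) := by
    field_simp
    ring
  rw [heq, le_div_iff₀ (by positivity), zero_mul] at htaylor
  linarith

theorem exists_deriv_sq_le_of_nonneg (hf : ContDiff ℝ 2 f) (hnonneg : ∀ t, 0 ≤ f t) (a b : ℝ) :
    ∃ K : NNReal, 0 < K ∧ LipschitzOnWith K (deriv f) (Icc a b) ∧
      ∀ x ∈ Icc a b, deriv f x ^ 2 ≤ 4 * K * f x := by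
  have hf' : ContDiff ℝ 1 (deriv f) := (contDiff_succ_iff_deriv (n := 1)).1 hf |>.2.2
  obtain ⟨K₀, hK₀⟩ := hf'.contDiffOn.exists_lipschitzOnWith one_ne_zero
    (convex_Icc (a - 1) (b + 1)) isCompact_Icc
  obtain ⟨K₁, hK₁⟩ := (isCompact_Icc (a := a) (b := b)).exists_bound_of_continuousOn
    hf'.continuous.continuousOn
  set K : NNReal := max 1 (max K₀ K₁.toNNReal)
  have hKpos : 0 < K := zero_lt_one.trans_le (le_max_left _ _)
  have hKlip : LipschitzOnWith K (deriv f) (Icc (a - 1) (b + 1)) :=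
    hK₀.weaken ((le_max_left _ _).trans (le_max_right _ _))
  refine ⟨K, hKpos, hKlip.mono (Icc_subset_Icc (by linarith) (by linarith)), fun x hx => ?_⟩
  have hK₁K : K₁ ≤ K := Real.toNNReal_le_iff_le_coe.1 ((le_max_right _ _).trans (le_max_right _ _))
  have hstep : |deriv f x / (2 * K)| ≤ 1 := by
    have : (0 : ℝ) < K := hKpos
    rw [abs_div, abs_of_pos (by positivity : (0 : ℝ) < 2 * K), div_le_one (by positivity)]
    linarith [(hK₁ x hx).trans hK₁K, Real.norm_eq_abs (deriv f x)]
  obtain ⟨hstep₁, hstep₂⟩ := abs_le.1 hstep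
  exact deriv_sq_le_of_nonneg (hf.differentiable two_ne_zero) ordConnected_Icc hKlip hKpos
    ⟨by linarith [hx.1], by linarith [hx.2]⟩ ⟨by linarith [hx.1], by linarith [hx.2]⟩ (hnonneg _)

theorem exists_le_mul_add_sq (hf : ContDiff ℝ 2 f) (hnonneg : ∀ t, 0 ≤ f t) (a b : ℝ) {δ : ℝ}
    (hδ : 0 < δ) :
    ∃ C, 0 ≤ C ∧ ∀ x ∈ Icc a b, ∀ y ∈ Icc a b, f y ≤ (1 + δ) * f x + C * (y - x) ^ 2 := by
  obtain ⟨K, hK, hlip, hderiv⟩ := exists_deriv_sq_le_of_nonneg hf hnonneg a b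
  have : (0 : ℝ) < K := hK
  refine ⟨K + K / δ, by positivity, fun x hx y hy => ?_⟩
  have htaylor := le_add_deriv_mul_add_sq (hf.differentiable two_ne_zero) ordConnected_Icc hlip
    hx hy
  have hyoung : deriv f x * (y - x) ≤ δ / (4 * K) * deriv f x ^ 2 + K / δ * (y - x) ^ 2 := by
    have hsq : δ / (4 * K) * deriv f x ^ 2 + K / δ * (y - x) ^ 2 - deriv f x * (y - x) =
        (δ * deriv f x - 2 * K * (y - x)) ^ 2 / (4 * K * δ) := by
      field_simp
      ring
    have hsq_nonneg : 0 ≤ (δ * deriv f x - 2 * K * (y - x)) ^ 2 / (4 * K * δ) := by positivity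
    linarith
  have hglaeser : δ / (4 * K) * deriv f x ^ 2 ≤ δ * f x := calc
    δ / (4 * K) * deriv f x ^ 2 ≤ δ / (4 * K) * (4 * K * f x) := by gcongr; exact hderiv x hx
    _ = δ * f x := by field_simp
  linarith

end Potential

section Energy

variable {n : ℕ} {N : Type*} [TopologicalSpace N] [ChartedSpace (Model n) N]
  [IsManifold (𝓡 (n + 1)) ∞ N] {g : SmoothMetric n N}

theorem metric_le_mul_add (x : N) {δ : ℝ} (hδ : 0 < δ) (v w : TangentSpace (𝓡 (n + 1)) x) :
    g.inner x w w ≤ (1 + δ) * g.inner x v v + (1 + 1 / δ) * g.inner x (w - v) (w - v) := by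
  have hsq : (1 + δ) * g.inner x v v + (1 + 1 / δ) * g.inner x (w - v) (w - v) - g.inner x w w =
      g.inner x ((1 + δ) • v - w) ((1 + δ) • v - w) / δ := by
    simp only [map_sub, map_smul, sub_apply, smul_apply, smul_eq_mul, g.symm x w v]
    field_simp
    ring
  have hnonneg := div_nonneg (metric_self_nonneg g x ((1 + δ) • v - w)) hδ.le
  linarith

variable [MeasurableSpace N] {W : ℝ → ℝ} {ε : ℝ}

/-- The integrand `ε |∇u|² / 2 + W(u) / ε` of the Allen–Cahn energy. -/
def energyDensity (W : ℝ → ℝ) (ε : ℝ) (u : H1 g) (x : N) : ℝ :=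
  ε * g.inner x (u.grad x) (u.grad x) / 2 + W (u x) / ε

theorem energyDensity_nonneg (hW : ∀ t, 0 ≤ W t) (hε : 0 < ε) (u : H1 g) (x : N) :
    0 ≤ energyDensity W ε u x := by
  have hgrad := metric_self_nonneg g x (u.grad x)
  have hpot := hW (u x)
  unfold energyDensity
  positivity

theorem energy_eq_lintegral (W : ℝ → ℝ) (ε : ℝ) (u : H1 g) :
    energy W ε u = ∫⁻ x, ENNReal.ofReal (energyDensity W ε u x) ∂vol g := rfl

theorem exists_energyDensity_le (hW : ContDiff ℝ 2 W) (hW₀ : ∀ t, 0 ≤ W t) (hε : 0 < ε) (a b : ℝ)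
    {δ : ℝ} (hδ : 0 < δ) :
    ∃ C, 0 ≤ C ∧ ∀ (u v : H1 g) (x : N), u x ∈ Icc a b → v x ∈ Icc a b →
      energyDensity W ε v x ≤ (1 + δ) * energyDensity W ε u x + C * ((v x - u x) ^ 2 +
        g.inner x (v.grad x - u.grad x) (v.grad x - u.grad x)) := by
  obtain ⟨C, hC₀, hC⟩ := exists_le_mul_add_sq hW hW₀ a b hδ
  refine ⟨C / ε + ε / 2 * (1 + 1 / δ), by positivity, fun u v x hu hv => ?_⟩
  have hgrad := metric_le_mul_add (g := g) x hδ (u.grad x) (v.grad x)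
  have hdiff := metric_self_nonneg g x (v.grad x - u.grad x)
  set A := g.inner x (u.grad x) (u.grad x)
  set B := g.inner x (v.grad x) (v.grad x)
  set D := g.inner x (v.grad x - u.grad x) (v.grad x - u.grad x)
  have hpot := hC (u x) hu (v x) hv
  have hDnonneg : 0 ≤ C / ε * D := by positivity
  have hsqnonneg : 0 ≤ ε / 2 * (1 + 1 / δ) * (v x - u x) ^ 2 := by positivity
  calc energyDensity W ε v x
      ≤ ε * ((1 + δ) * A + (1 + 1 / δ) * D) / 2 +
        ((1 + δ) * W (u x) + C * (v x - u x) ^ 2) / ε := by unfold energyDensity; gcongr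
    _ = (1 + δ) * energyDensity W ε u x + (ε / 2 * (1 + 1 / δ) * D + C / ε * (v x - u x) ^ 2) := by
        unfold energyDensity; ring
    _ ≤ (1 + δ) * energyDensity W ε u x +
        (C / ε + ε / 2 * (1 + 1 / δ)) * ((v x - u x) ^ 2 + D) := by linarith

variable [BorelSpace N] [LindelofSpace N]

theorem aemeasurable_energyDensity (hW : Measurable W) (u : H1 g) :
    AEMeasurable (energyDensity W ε u) (vol g) :=
  (((u.isL2Gradient.integrable_metric u.isL2Gradient).1.aemeasurable.const_mul ε).div_const 2).add
    ((hW.comp_aemeasurable u.isL2Gradient.memLp.1.aemeasurable).div_const ε)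

theorem energyDensity_sup_add_inf (W : ℝ → ℝ) (ε : ℝ) (u v : H1 g) :
    ∀ᵐ x ∂vol g, energyDensity W ε (u ⊔ v) x + energyDensity W ε (u ⊓ v) x =
      energyDensity W ε u x + energyDensity W ε v x := by
  filter_upwards [H1.coe_sup u v, H1.coe_inf u v, H1.grad_sup u v, H1.grad_inf u v]
    with x hsup hinf hgradsup hgradinf
  simp only [energyDensity, hsup, hinf, hgradsup, hgradinf]
  split_ifs with h
  · rw [sup_eq_left.2 h, inf_eq_right.2 h]
  · rw [sup_eq_right.2 (not_le.1 h).le, inf_eq_left.2 (not_le.1 h).le, add_comm]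

theorem energy_sup_add_inf (hW : Measurable W) (hW₀ : ∀ t, 0 ≤ W t) (hε : 0 < ε) (u v : H1 g) :
    energy W ε (u ⊔ v) + energy W ε (u ⊓ v) = energy W ε u + energy W ε v := by
  have hmeas (w : H1 g) : AEMeasurable (fun x => ENNReal.ofReal (energyDensity W ε w x)) (vol g) :=
    (aemeasurable_energyDensity hW w).ennreal_ofReal
  simp only [energy_eq_lintegral]
  rw [← lintegral_add_left' (hmeas _), ← lintegral_add_left' (hmeas _)]
  refine lintegral_congr_ae ?_
  filter_upwards [energyDensity_sup_add_inf W ε u v] with x hx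
  have hnonneg (w : H1 g) := energyDensity_nonneg hW₀ hε w x
  rw [← ENNReal.ofReal_add (hnonneg _) (hnonneg _), hx, ENNReal.ofReal_add (hnonneg _) (hnonneg _)]

/-- The functions in `H¹(N)` with values in the interval `[a, b]`. -/
def valuedIn (g : SmoothMetric n N) (a b : ℝ) : Set (H1 g) :=
  {u | ∀ᵐ x ∂vol g, u x ∈ Icc a b}

theorem convex_valuedIn (a b : ℝ) : Convex ℝ (valuedIn g a b) := by
  intro u hu v hv s t hs ht hst
  filter_upwards [hu, hv, H1.coe_add (s • u) (t • v), H1.coe_smul s u, H1.coe_smul t v]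
    with x hux hvx hadd hsu htv
  rw [hadd, hsu, htv]
  exact convex_Icc a b hux hvx hs ht hst

theorem isSublattice_valuedIn (a b : ℝ) : IsSublattice (valuedIn g a b) where
  supClosed u hu v hv := by
    filter_upwards [hu, hv, H1.coe_sup u v] with x hux hvx hsup
    exact hsup ▸ ⟨le_sup_of_le_left hux.1, sup_le hux.2 hvx.2⟩
  infClosed u hu v hv := by
    filter_upwards [hu, hv, H1.coe_inf u v] with x hux hvx hinf
    exact hinf ▸ ⟨le_inf hux.1 hvx.1, inf_le_of_left_le hux.2⟩

theorem exists_energy_le (hW : ContDiff ℝ 2 W) (hW₀ : ∀ t, 0 ≤ W t) (hε : 0 < ε) (a b : ℝ)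
    {δ : ℝ} (hδ : 0 < δ) :
    ∃ C, ∀ u ∈ valuedIn g a b, ∀ v ∈ valuedIn g a b, energy W ε v ≤
      ENNReal.ofReal (1 + δ) * energy W ε u + ENNReal.ofReal (C * ‖v - u‖ ^ 2) := by
  obtain ⟨C, hC₀, hC⟩ := exists_energyDensity_le (g := g) hW hW₀ hε a b hδ
  refine ⟨C, fun u hu v hv => ?_⟩
  have hmeas := (aemeasurable_energyDensity (ε := ε) hW.continuous.measurable u).ennreal_ofReal
  rw [ENNReal.ofReal_mul hC₀, H1.ofReal_norm_sq, energy_eq_lintegral, energy_eq_lintegral,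
    ← lintegral_const_mul' _ _ ENNReal.ofReal_ne_top,
    ← lintegral_const_mul' _ _ ENNReal.ofReal_ne_top, ← lintegral_add_left' (hmeas.const_mul _)]
  refine lintegral_mono_ae ?_
  filter_upwards [hu, hv, H1.coe_sub v u, H1.grad_sub v u] with x hux hvx hsub hgrad
  rw [hsub, hgrad, ← ENNReal.ofReal_mul (by positivity), ← ENNReal.ofReal_mul hC₀]
  exact (ENNReal.ofReal_le_ofReal (hC u v x hux hvx)).trans ENNReal.ofReal_add_le

theorem upperSemicontinuousOn_energy (hW : ContDiff ℝ 2 W) (hW₀ : ∀ t, 0 ≤ W t) (hε : 0 < ε)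
    (a b : ℝ) : UpperSemicontinuousOn (energy W ε) (valuedIn g a b) := by
  intro u hu L hL
  have hscale : Tendsto (fun δ => ENNReal.ofReal (1 + δ) * energy W ε u) (𝓝[>] 0)
      (𝓝 (energy W ε u)) := by
    have hone : Tendsto (fun δ : ℝ => ENNReal.ofReal (1 + δ)) (𝓝[>] 0) (𝓝 1) :=
      tendsto_nhdsWithin_of_tendsto_nhds (Continuous.tendsto'
        (ENNReal.continuous_ofReal.comp (by fun_prop)) _ _ (by simp))
    simpa using ENNReal.Tendsto.mul_const hone (Or.inl one_ne_zero)
  obtain ⟨δ, hδL, hδ⟩ :=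
    ((hscale.eventually (eventually_lt_nhds hL)).and self_mem_nhdsWithin).exists
  obtain ⟨C, hC⟩ := exists_energy_le (g := g) hW hW₀ hε a b hδ
  have hbound : Tendsto (fun v : H1 g => ENNReal.ofReal (1 + δ) * energy W ε u +
      ENNReal.ofReal (C * ‖v - u‖ ^ 2)) (𝓝[valuedIn g a b] u)
      (𝓝 (ENNReal.ofReal (1 + δ) * energy W ε u)) := by
    refine tendsto_nhdsWithin_of_tendsto_nhds (Continuous.tendsto' ?_ _ _ (by simp))
    exact continuous_const.add (ENNReal.continuous_ofReal.comp (by fun_prop))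
  filter_upwards [hbound.eventually (eventually_lt_nhds hδL), self_mem_nhdsWithin] with v hvL hv
  exact (hC u hu v hv).trans_lt hvL

end Energy

section NestedReach

theorem antitone_trans {X : Type*} [TopologicalSpace X] [Preorder X] {a b c : X} {γ : Path a b}
    {γ' : Path b c} (hγ : Antitone γ) (hγ' : Antitone γ') : Antitone (γ.trans γ') := by
  intro s t hst
  have hst : (s : ℝ) ≤ t := hst
  simp only [Path.trans_apply]
  split_ifs with ht hs hs
  · exact hγ (Subtype.mk_le_mk.2 (by linarith))
  · linarith
  · exact (hγ' unitInterval.nonneg').trans <|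
      (γ'.source.trans γ.target.symm).le.trans (hγ unitInterval.le_one')
  · exact hγ' (Subtype.mk_le_mk.2 (by linarith))

theorem le_add_of_add_le_add {p q r s δ : ℝ≥0∞} (h : p + q ≤ r + s) (hs : s ≤ q + δ)
    (hs' : s ≠ ⊤) : p ≤ r + δ := by
  rcases eq_or_ne q ⊤ with rfl | hq
  · have hr : r = ⊤ := by simpa [hs'] using h
    simp [hr]
  · refine (ENNReal.add_le_add_iff_right hq).1 (h.trans ?_)
    rw [add_assoc, add_comm δ]
    gcongr

theorem exists_near_minimizer {α : Type*} {F : α → ℝ≥0∞} {Z : Set α} {u : α} {δ : ℝ≥0∞}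
    (hu : u ∈ Z) (hF : F u ≠ ⊤) (hδ : δ ≠ 0) :
    ∃ z ∈ Z, F z ≠ ⊤ ∧ ∀ z' ∈ Z, F z ≤ F z' + δ := by
  have hinf_le (z : α) (hz : z ∈ Z) : sInf (F '' Z) ≤ F z := sInf_le (mem_image_of_mem F hz)
  have hinf : sInf (F '' Z) ≠ ⊤ := ((hinf_le u hu).trans_lt hF.lt_top).ne
  obtain ⟨_, ⟨z, hz, rfl⟩, hzF⟩ := sInf_lt_iff.1 (ENNReal.lt_add_right hinf hδ)
  exact ⟨z, hz, hzF.ne_top, fun z' hz' => hzF.le.trans (by gcongr; exact hinf_le z' hz')⟩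

variable {E : Type*} [TopologicalSpace E] [Lattice E] {F : E → ℝ≥0∞} {S : Set E}
  {L M δ : ℝ≥0∞} {u v w : E}

/-- `v` is reached from `u` below the level `L`: some decreasing path in `S` starts above `u`, ends
below `v`, and satisfies `F ≤ L`. -/
def NestedReach (F : E → ℝ≥0∞) (S : Set E) (L : ℝ≥0∞) (u v : E) : Prop :=
  ∃ (a b : E) (γ : Path a b), u ≤ a ∧ b ≤ v ∧ Antitone γ ∧ ∀ t, γ t ∈ S ∧ F (γ t) ≤ L

namespace NestedReach

theorem mono (h : NestedReach F S L u v) (hLM : L ≤ M) : NestedReach F S M u v :=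
  have ⟨a, b, γ, hua, hbv, hγ, hS⟩ := h
  ⟨a, b, γ, hua, hbv, hγ, fun t => ⟨(hS t).1, (hS t).2.trans hLM⟩⟩

theorem trans_add [ContinuousSup E] [ContinuousInf E] (hS : IsSublattice S)
    (hF : ∀ u v, F (u ⊔ v) + F (u ⊓ v) ≤ F u + F v) (hL : L ≠ ⊤) (hδ : δ ≠ 0)
    (huv : NestedReach F S L u v) (hvw : NestedReach F S L v w) : NestedReach F S (L + δ) u w := by
  obtain ⟨a, b, α, hua, hbv, hα, hαS⟩ := huv
  obtain ⟨c, d, β, hvc, hdw, hβ, hβS⟩ := hvw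
  have hb (t : unitInterval) : b ≤ α t := α.target.symm.le.trans (hα unitInterval.le_one')
  have hc (t : unitInterval) : β t ≤ c := (hβ unitInterval.nonneg').trans β.source.le
  obtain ⟨hbS, hbL⟩ : b ∈ S ∧ F b ≤ L := by simpa using hαS 1
  obtain ⟨z, ⟨hzS, hbz, hzc⟩, hz, hmin⟩ := exists_near_minimizer (F := F) (Z := S ∩ Icc b c)
    ⟨hbS, le_rfl, hbv.trans hvc⟩ (hbL.trans_lt hL.lt_top).ne hδ
  let γ : Path (a ⊔ z) z := (α.map (continuous_id.sup continuous_const)).cast rfl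
    (sup_eq_right.2 hbz).symm
  let γ' : Path z (d ⊓ z) := (β.map (continuous_id.inf continuous_const)).cast
    (inf_eq_right.2 hzc).symm rfl
  have hγ (t : unitInterval) : γ t ∈ S ∧ F (γ t) ≤ L + δ := by
    obtain ⟨hαtS, hαtL⟩ := hαS t
    refine ⟨hS.supClosed hαtS hzS, (le_add_of_add_le_add (hF (α t) z) (hmin _ ?_) hz).trans
      (by gcongr)⟩
    exact ⟨hS.infClosed hαtS hzS, le_inf (hb t) hbz, inf_le_of_right_le hzc⟩
  have hγ' (t : unitInterval) : γ' t ∈ S ∧ F (γ' t) ≤ L + δ := by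
    obtain ⟨hβtS, hβtL⟩ := hβS t
    refine ⟨hS.infClosed hβtS hzS, (le_add_of_add_le_add ((add_comm _ _).trans_le (hF (β t) z))
      (hmin _ ?_) hz).trans (by gcongr)⟩
    exact ⟨hS.supClosed hβtS hzS, le_sup_of_le_right hbz, sup_le (hc t) hzc⟩
  refine ⟨_, _, γ.trans γ', le_sup_of_le_left hua, inf_le_of_left_le hdw,
    antitone_trans (fun s t hst => sup_le_sup_right (hα hst) z)
      fun s t hst => inf_le_inf_right z (hβ hst), fun t => ?_⟩
  rw [Path.trans_apply]
  split_ifs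
  exacts [hγ _, hγ' _]

theorem of_segment [AddCommGroup E] [IsOrderedAddMonoid E] [Module ℝ E] [SMulPosMono ℝ E]
    [ContinuousAdd E] [ContinuousSMul ℝ E] (hwu : w ≤ u) (hwv : w ≤ v)
    (hseg : segment ℝ u w ⊆ {z | z ∈ S ∧ F z ≤ L}) : NestedReach F S L u v := by
  refine ⟨u, w, Path.segment u w, le_rfl, hwv, (AffineMap.lineMap_anti hwu).comp_monotone
    (Subtype.mono_coe _), fun t => hseg ?_⟩
  rw [← Path.range_segment]
  exact mem_range_self t

end NestedReach

variable [AddCommGroup E] [IsOrderedAddMonoid E] [Module ℝ E] [SMulPosMono ℝ E] [ContinuousAdd E]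
  [ContinuousSMul ℝ E] [ContinuousInf E]

theorem eventually_nestedReach [LocallyConvexSpace ℝ E] (hS : IsSublattice S)
    (hSconv : Convex ℝ S) (hF : UpperSemicontinuousOn F S) (hu : u ∈ S) (huL : F u < L) :
    ∀ᶠ v in 𝓝[S] u, NestedReach F S L u v ∧ NestedReach F S L v u := by
  obtain ⟨V, hV, hVL⟩ := mem_nhdsWithin_iff_exists_mem_nhds_inter.1 (hF u hu L huL)
  obtain ⟨C, ⟨hC, hCconv⟩, hCV⟩ := (LocallyConvexSpace.convex_basis (𝕜 := ℝ) u).mem_iff.1 hV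
  have hinf : Tendsto (fun v => u ⊓ v) (𝓝 u) (𝓝 u) :=
    (continuous_const.inf continuous_id).tendsto' _ _ (inf_idem u)
  filter_upwards [self_mem_nhdsWithin, mem_nhdsWithin_of_mem_nhds hC,
    mem_nhdsWithin_of_mem_nhds (hinf hC)] with v hvS hvC hinfC
  have hseg (w : E) (hwS : w ∈ S) (hwC : w ∈ C) :
      segment ℝ w (u ⊓ v) ⊆ {z | z ∈ S ∧ F z ≤ L} := fun z hz =>
    have hzS := hSconv.segment_subset hwS (hS.infClosed hu hvS) hz
    ⟨hzS, (hVL ⟨hCV (hCconv.segment_subset hwC hinfC hz), hzS⟩).le⟩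
  exact ⟨.of_segment inf_le_left inf_le_right (hseg u hu (mem_of_mem_nhds hC)),
    .of_segment inf_le_right inf_le_left (hseg v hvS hvC)⟩

theorem nestedReach_of_forall_lt [ContinuousSup E] [LocallyConvexSpace ℝ E] (hS : IsSublattice S)
    (hSconv : Convex ℝ S) (hF : UpperSemicontinuousOn F S)
    (hsub : ∀ u v, F (u ⊔ v) + F (u ⊓ v) ≤ F u + F v) {T : Type*} [TopologicalSpace T]
    [PreconnectedSpace T] {φ : T → E} (hφ : Continuous φ) (hφS : ∀ t, φ t ∈ S)
    (hφL : ∀ t, F (φ t) < L) (s t : T) : NestedReach F S L (φ s) (φ t) := by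
  suffices h : ∃ M < L, NestedReach F S M (φ s) (φ t) from
    have ⟨_, hML, hM⟩ := h
    hM.mono hML.le
  refine PreconnectedSpace.induction₂' (fun s t => ∃ M < L, NestedReach F S M (φ s) (φ t))
    (fun s => ?_) ⟨?_⟩ s t
  · obtain ⟨M, hsM, hML⟩ := exists_between (hφL s)
    have hφs : Tendsto φ (𝓝 s) (𝓝[S] φ s) :=
      tendsto_nhdsWithin_iff.2 ⟨hφ.tendsto s, Eventually.of_forall hφS⟩
    filter_upwards [hφs.eventually (eventually_nestedReach hS hSconv hF (hφS s) hsM)] with t ht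
    exact ⟨⟨M, hML, ht.1⟩, M, hML, ht.2⟩
  · rintro r s t ⟨M, hM, hrs⟩ ⟨M', hM', hst⟩
    have hmax : max M M' < L := max_lt hM hM'
    obtain ⟨δ, hδ, hδL⟩ := ENNReal.lt_iff_exists_add_pos_lt.1 hmax
    exact ⟨_, hδL, (hrs.mono (le_max_left _ _)).trans_add hS hsub hmax.ne_top
      (ENNReal.coe_ne_zero.2 hδ.ne') (hst.mono (le_max_right _ _))⟩

theorem exists_nestedReach_iSup_add [ContinuousSup E] [LocallyConvexSpace ℝ E]
    (hS : IsSublattice S) (hSconv : Convex ℝ S) (hF : UpperSemicontinuousOn F S)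
    (hsub : ∀ u v, F (u ⊔ v) + F (u ⊓ v) ≤ F u + F v) {T : Type*} [TopologicalSpace T]
    [PreconnectedSpace T] {φ : T → E} (hφ : Continuous φ) (hφS : ∀ t, φ t ∈ S) (hδ : δ ≠ 0)
    (s t : T) : NestedReach F S ((⨆ r, F (φ r)) + δ) (φ s) (φ t) := by
  rcases eq_or_ne (⨆ r, F (φ r)) ⊤ with htop | htop
  · rw [htop, top_add]
    exact .of_segment inf_le_left inf_le_right fun z hz =>
      ⟨hSconv.segment_subset (hφS s) (hS.infClosed (hφS s) (hφS t)) hz, le_top⟩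
  · exact nestedReach_of_forall_lt hS hSconv hF hsub hφ hφS (fun r =>
      (le_iSup (fun r => F (φ r)) r).trans_lt (ENNReal.lt_add_right htop hδ)) s t

end NestedReach

end AllenCahn

end

theorem proposition3p5_general (n : ℕ) (N : Type*) [TopologicalSpace N] [LindelofSpace N]
    [ChartedSpace (AllenCahn.Model n) N] [IsManifold (𝓡 (n + 1)) ∞ N]
    [MeasurableSpace N] [BorelSpace N] (g : AllenCahn.SmoothMetric n N)
    (W : ℝ → ℝ) (hW : ContDiff ℝ 2 W) (hW₀ : ∀ t, 0 ≤ W t) (ε : ℝ) (hε : 0 < ε) (a b : ℝ)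
    (φ : unitInterval → AllenCahn.H1 g) (hφ : AllenCahn.ContinuousPath φ)
    (hφab : ∀ t, ∀ᵐ x ∂(AllenCahn.vol g), φ t x ∈ Icc a b) (κ : ℝ) (hκ : 0 < κ) :
    ∃ ψ : unitInterval → AllenCahn.H1 g,
      AllenCahn.IsNested ψ ∧
      (∀ᵐ x ∂(AllenCahn.vol g), φ 0 x ≤ ψ 0 x) ∧
      (∀ᵐ x ∂(AllenCahn.vol g), ψ 1 x ≤ φ 1 x) ∧
      (∀ t, ∀ᵐ x ∂(AllenCahn.vol g), ψ t x ∈ Icc a b) ∧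
      (⨆ t, AllenCahn.energy W ε (ψ t)) ≤
        (⨆ t, AllenCahn.energy W ε (φ t)) + ENNReal.ofReal κ := by
  obtain ⟨_, _, ψ, h₀, h₁, hanti, hψ⟩ := AllenCahn.exists_nestedReach_iSup_add
    (AllenCahn.isSublattice_valuedIn a b) (AllenCahn.convex_valuedIn a b)
    (AllenCahn.upperSemicontinuousOn_energy hW hW₀ hε a b)
    (fun u v => (AllenCahn.energy_sup_add_inf hW.continuous.measurable hW₀ hε u v).le)
    (AllenCahn.H1.continuousPath_iff.1 hφ) hφab (ENNReal.ofReal_pos.2 hκ).ne' 0 1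
  exact ⟨ψ, AllenCahn.H1.isNested_iff.2 ⟨ψ.continuous, hanti⟩,
    AllenCahn.H1.le_iff.1 (h₀.trans_eq ψ.source.symm),
    AllenCahn.H1.le_iff.1 (ψ.target.trans_le h₁),
    fun t => (hψ t).1, iSup_le fun t => (hψ t).2⟩

theorem proposition3p5 (n : ℕ) (N : Type*) [TopologicalSpace N] [T2Space N] [CompactSpace N]
    [ChartedSpace (AllenCahn.Model n) N] [IsManifold (𝓡 (n + 1)) ∞ N]
    [MeasurableSpace N] [BorelSpace N] (g : AllenCahn.SmoothMetric n N)
    (W : ℝ → ℝ) (hW : AllenCahn.IsDoubleWell W) (ε : ℝ) (hε : 0 < ε)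
    (φ : unitInterval → AllenCahn.H1 g) (hφ : AllenCahn.ContinuousPath φ)
    (hφ1 : ∀ t, ∀ᵐ x ∂(AllenCahn.vol g), |φ t x| ≤ 1) (κ : ℝ) (hκ : 0 < κ) :
    ∃ ψ : unitInterval → AllenCahn.H1 g,
      AllenCahn.IsNested ψ ∧
      (∀ᵐ x ∂(AllenCahn.vol g), φ 0 x ≤ ψ 0 x) ∧
      (∀ᵐ x ∂(AllenCahn.vol g), ψ 1 x ≤ φ 1 x) ∧
      (∀ t, ∀ᵐ x ∂(AllenCahn.vol g), |ψ t x| ≤ 1) ∧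
      (⨆ t, AllenCahn.energy W ε (ψ t)) ≤
        (⨆ t, AllenCahn.energy W ε (φ t)) + ENNReal.ofReal κ := by
  simp only [abs_le] at hφ1 ⊢
  exact proposition3p5_general n N g W (contDiff_infty.1 hW.contDiff 2) hW.nonneg ε hε (-1) 1
    φ hφ hφ1 κ hκ
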